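/- All groups are abelian and written additively. A subgroup $H$ of a group $A$ is called essential in a subgroup $S\le A$ if $H\le S$ and $H\cap K\neq 0$ for every non-zero subgroup $K\le S$. A group $G$ is called semi-generalized co-Bassian if, for every subgroup $H\le G$ and every injective homomorphism $\varphi\colon G\to G/H$, the image $\varphi(G)$ is essential in some direct summand of $G/H$. For a prime $p$, let $G_{(p)}=G\otimes_{\mathbb Z}\mathbb Z_{(p)}$ denote the localization of $G$ at $p$, regarded as an abelian group. Let $G$ be an abelian group of finite torsion-free rank. Then $G$ is semi-generalized co-Bassian if and only if, for every prime $p$, its localization $G_{(p)}$ is semi-generalized co-Bassian. -/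

import Mathlib

/-- The subgroup `H` is an essential subgroup of the subgroup `S`: it is contained in `S` and meets
every non-zero subgroup of `S` in a non-zero subgroup. -/
def IsEssentialIn {A : Type*} [AddCommGroup A] (H S : AddSubgroup A) : Prop :=
  H ≤ S ∧ ∀ K : AddSubgroup A, K ≤ S → K ≠ ⊥ → H ⊓ K ≠ ⊥

/-- The subgroup `S` is a direct summand of the abelian group `A`: there is a subgroup `C` with
`S ⊓ C = ⊥` and `S ⊔ C = ⊤`. -/
def IsDirectSummand {A : Type*} [AddCommGroup A] (S : AddSubgroup A) : Prop :=
  ∃ C : AddSubgroup A, IsCompl S C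

/-- An abelian group `G` is semi-generalized co-Bassian if for every subgroup `H` of `G` and every
injective homomorphism `φ : G → G ⧸ H`, the image of `φ` is essential in some direct summand of
`G ⧸ H`. -/
def IsSemiGenCoBassian (G : Type*) [AddCommGroup G] : Prop :=
  ∀ (H : AddSubgroup G) (φ : G →+ G ⧸ H), Function.Injective φ →
    ∃ S : AddSubgroup (G ⧸ H), IsDirectSummand S ∧ IsEssentialIn φ.range S

/-- The torsion-free rank of `G`, that is, the supremum of the cardinalities of its subsets that are
linearly independent over `ℤ`, is finite. -/
def HasFiniteTorsionFreeRank (G : Type*) [AddCommGroup G] : Prop :=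
  Module.rank ℤ G < Cardinal.aleph0

theorem isPrime_span_intCast_prime (p : ℕ) [hp : Fact p.Prime] :
    (Ideal.span {(p : ℤ)}).IsPrime :=
  (Ideal.span_singleton_prime (Nat.cast_ne_zero.mpr hp.out.ne_zero)).mpr
    (Nat.prime_iff_prime_int.mp hp.out)

/-- The multiplicative set of the integers that are not divisible by the prime `p`. -/
abbrev primeToMonoid (p : ℕ) [Fact p.Prime] : Submonoid ℤ :=
  @Ideal.primeCompl ℤ _ (Ideal.span {(p : ℤ)}) (isPrime_span_intCast_prime p)

/-- The localization `G_(p)` of the abelian group `G` at the prime `p`: fractions `g / s` with `g`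
in `G` and `s` an integer not divisible by `p`. -/
abbrev LocalizationAtPrime (p : ℕ) [Fact p.Prime] (G : Type*) [AddCommGroup G] :=
  LocalizedModule (primeToMonoid p) G

/-! For finite torsion-free rank, `G` is semi-generalized co-Bassian exactly if `PrimeCondition p G`
holds for every prime `p`. That condition only involves the `p`-torsion `T` of `G`, heights in it,
and whether `G = T + pG`. None of this changes in `G_(p)` (`IsLocallyBijective.primeCondition_iff`),
and for `q ≠ p` the group `G_(p)` has no `q`-torsion, so its condition at `q` is trivial.
Localization keeps the rank finite, and the theorem follows.

Necessity (`IsSemiGenCoBassian.primeCondition`) holds for any rank. If the condition fails, an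
infinite direct sum of cyclic `p`-groups inside `G` leaves room for a quotient `ℤ/p^m × A` of `G`
with `G` embedded in `A`. A suitable embedding of `G` into this quotient, or into `ℤ/p × A`, forces
every summand that contains the image to have an element of order `p` with non-zero cyclic
coordinate; elements of order `p` in the image have none.

Sufficiency (`isSemiGenCoBassian_of_primeCondition`): for a surjection `σ : G → A` and an embedding
`φ : G → A`, finite rank makes `ker σ` and `A/φ(G)` torsion, so a complement can be built one prime
at a time. Needed is a `p`-primary `C ≤ A` that meets `φ(G)` trivially, with `A[p] ≤ φ(G) + C`,
whose image splits off the `p`-part of `A/φ(G)`. Inside the `p`-part of `A` this is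
`exists_isCompl_of_heights`; its height hypothesis follows from the first part of the condition by
counting elements of order `p`. The second part of the condition handles the passage to `A/φ(G)`. -/

/-! ### Direct summands: divisible subgroups and pure subgroups -/

theorem AddSubgroup.exists_isCompl_of_retraction {M : Type*} [AddCommGroup M] (D : AddSubgroup M)
    (r : M →+ D) (hr : ∀ d : D, r d = d) : IsCompl D r.ker := by
  refine IsCompl.of_eq ?_ ?_
  · rw [eq_bot_iff]
    rintro x ⟨hx, hx'⟩
    have h1 := hr ⟨x, hx⟩
    have h2 : r x = 0 := hx'
    simp only [h2] at h1
    simpa using (congrArg Subtype.val h1).symm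
  · rw [eq_top_iff]
    rintro x -
    refine AddSubgroup.mem_sup.mpr ⟨r x, (r x).2, x - r x, ?_, by abel⟩
    rw [AddMonoidHom.mem_ker, map_sub, hr, sub_self]

theorem AddSubgroup.isCompl_mem_eq_zero {M : Type*} [AddCommGroup M] {S C : AddSubgroup M}
    (h : IsCompl S C) {x : M} (hS : x ∈ S) (hC : x ∈ C) : x = 0 := by
  have : x ∈ S ⊓ C := ⟨hS, hC⟩
  rwa [h.inf_eq_bot] at this

theorem AddSubgroup.isCompl_exists_add {M : Type*} [AddCommGroup M] {S C : AddSubgroup M}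
    (h : IsCompl S C) (x : M) : ∃ s ∈ S, ∃ c ∈ C, s + c = x := by
  have : x ∈ S ⊔ C := by rw [h.sup_eq_top]; trivial
  exact AddSubgroup.mem_sup.mp this

theorem AddSubgroup.exists_projection_of_isCompl {M : Type*} [AddCommGroup M]
    {S C : AddSubgroup M} (h : IsCompl S C) :
    ∃ π : M →+ M, (∀ s ∈ S, π s = 0) ∧ (∀ c ∈ C, π c = c) ∧ (∀ x, π x ∈ C) ∧
      ∀ x, x - π x ∈ S := by
  choose f hf g hg hfg using AddSubgroup.isCompl_exists_add h
  have key : ∀ s ∈ S, ∀ c ∈ C, g (s + c) = c := by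
    intro s hs c hc
    have h1 := hfg (s + c)
    have h2 : f (s + c) - s = c - g (s + c) := by
      rw [sub_eq_sub_iff_add_eq_add, h1]; abel
    have h3 : c - g (s + c) = 0 :=
      AddSubgroup.isCompl_mem_eq_zero h (h2 ▸ S.sub_mem (hf _) hs) (C.sub_mem hc (hg _))
    exact (sub_eq_zero.mp h3).symm
  refine ⟨AddMonoidHom.mk' g fun x y => ?_, fun s hs => ?_, fun c hc => ?_, hg, fun x => ?_⟩
  · have : x + y = (f x + f y) + (g x + g y) := by
      nth_rewrite 1 [← hfg x, ← hfg y]; abel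
    rw [this, key _ (S.add_mem (hf x) (hf y)) _ (C.add_mem (hg x) (hg y))]
  · simpa using key s hs 0 C.zero_mem
  · simpa using key 0 S.zero_mem c hc
  · have : x - g x = f x := by nth_rewrite 1 [← hfg x]; abel
    change x - g x ∈ S
    rw [this]; exact hf x

theorem AddSubgroup.mem_sSup_of_isChain {M : Type*} [AddCommGroup M] {c : Set (AddSubgroup M)}
    (hc : IsChain (· ≤ ·) c) (hne : c.Nonempty) {x : M} : x ∈ sSup c ↔ ∃ K ∈ c, x ∈ K :=
  AddSubgroup.mem_sSup_of_directedOn hne hc.directedOn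

theorem AddMonoidHom.exists_extension_of_divisible {A X Y : Type*} [AddCommGroup A]
    [AddCommGroup X] [AddCommGroup Y] (hA : ∀ n : ℤ, n ≠ 0 → ∀ a : A, ∃ b : A, n • b = a)
    (f : X →+ Y) (hf : Function.Injective f) (g : X →+ A) :
    ∃ h : Y →+ A, ∀ x, h (f x) = g x := by
  let _ : DivisibleBy A ℤ := divisibleByOfSMulRightSurj A ℤ fun {n} hn a => hA n hn a
  obtain ⟨h, hh⟩ := (Module.Baer.of_divisible A).extension_property_addMonoidHom f hf g
  exact ⟨h, fun x => DFunLike.congr_fun hh x⟩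

/-- By Bézout, an integer prime to the order of an element acts invertibly on it, and the inverse is
again multiplication by an integer. This is how coefficients prime to `p` are discarded throughout.
-/
theorem exists_zsmul_eq_of_coprime {A : Type*} [AddCommGroup A] {p : ℕ} {n : ℤ} {e : ℕ}
    (hn : IsCoprime n (p ^ e : ℤ)) {a : A} (ha : p ^ e • a = 0) : ∃ k : ℤ, n • (k • a) = a := by
  obtain ⟨u, v, huv⟩ := hn
  refine ⟨u, ?_⟩
  have h : (u * n + v * (p ^ e : ℤ)) • a = a := by rw [huv, one_smul]
  rw [add_smul, mul_smul, mul_smul] at h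
  have h2 : ((p : ℤ) ^ e) • a = 0 := by rw [← ha, ← natCast_zsmul]; norm_cast
  rw [h2, smul_zero, add_zero] at h
  rw [smul_comm]; exact h

theorem Int.isCoprime_prime_pow {p : ℕ} (hp : p.Prime) {n : ℤ} (hn : ¬ (p : ℤ) ∣ n) (e : ℕ) :
    IsCoprime n (p ^ e : ℤ) :=
  IsCoprime.pow_right ((Nat.prime_iff_prime_int.mp hp).coprime_iff_not_dvd.mpr hn).symm

theorem exists_zsmul_eq_of_prime_divisible {A : Type*} [AddCommGroup A] {p : ℕ} (hp : p.Prime)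
    (htor : ∀ x : A, ∃ e : ℕ, p ^ e • x = 0) (hdiv : ∀ x : A, ∃ y : A, p • y = x)
    (n : ℤ) (hn : n ≠ 0) (a : A) : ∃ b : A, n • b = a := by
  have hfin : FiniteMultiplicity (p : ℤ) n :=
    Int.finiteMultiplicity_iff.mpr ⟨by simpa using hp.ne_one, hn⟩
  obtain ⟨m, hm, hpm⟩ := hfin.exists_eq_pow_mul_and_not_dvd
  have hpow : ∀ k : ℕ, ∀ x : A, ∃ y : A, p ^ k • y = x := by
    intro k
    induction k with
    | zero => exact fun x => ⟨x, by simp⟩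
    | succ k ih =>
      intro x
      obtain ⟨y, hy⟩ := hdiv x
      obtain ⟨z, hz⟩ := ih y
      exact ⟨z, by rw [pow_succ', mul_smul, hz, hy]⟩
  obtain ⟨b, hb⟩ := hpow (multiplicity (p : ℤ) n) a
  obtain ⟨e, he⟩ := htor b
  obtain ⟨k, hk⟩ := exists_zsmul_eq_of_coprime (Int.isCoprime_prime_pow hp hpm e) he
  refine ⟨k • b, ?_⟩
  rw [hm, mul_smul, hk, ← hb, ← natCast_zsmul]
  norm_cast

theorem AddSubgroup.exists_isCompl_of_prime_divisible {M : Type*} [AddCommGroup M] {p : ℕ}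
    (hp : p.Prime) (D : AddSubgroup M) (htor : ∀ x ∈ D, ∃ e : ℕ, p ^ e • x = 0)
    (hdiv : ∀ x ∈ D, ∃ y ∈ D, p • y = x) : ∃ C, IsCompl D C := by
  have hD : ∀ n : ℤ, n ≠ 0 → ∀ a : D, ∃ b : D, n • b = a :=
    exists_zsmul_eq_of_prime_divisible hp
      (fun x => (htor x x.2).imp fun e he => Subtype.ext (by simpa using he))
      (fun x => (hdiv x x.2).elim fun y hy => ⟨⟨y, hy.1⟩, Subtype.ext (by simpa using hy.2)⟩)
  obtain ⟨r, hr⟩ := AddMonoidHom.exists_extension_of_divisible hD D.subtype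
    D.subtype_injective (AddMonoidHom.id D)
  exact ⟨_, AddSubgroup.exists_isCompl_of_retraction D r hr⟩

/-- A Zorn argument: `C` is maximal such that elements of `B` divisible by `p ^ i` modulo `C` are
divisible by `p ^ i` in `B`. For `i = N` this forces `B ⊓ C = ⊥`. If `B ⊔ C` were proper, an element
outside it, of order `p` and maximal height modulo `C`, could be adjoined to `C`. -/
theorem AddSubgroup.exists_isCompl_of_pure_of_bounded {M : Type*} [AddCommGroup M] {p : ℕ}
    (hp : p.Prime) (B : AddSubgroup M) (N : ℕ) (hN : ∀ b ∈ B, p ^ N • b = 0)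
    (hpure : ∀ (i : ℕ) (m : M), p ^ i • m ∈ B → ∃ b ∈ B, p ^ i • b = p ^ i • m) :
    ∃ C, IsCompl B C := by
  let s : Set (AddSubgroup M) :=
    {C | ∀ (i : ℕ) (m : M), ∀ c ∈ C, p ^ i • m + c ∈ B → ∃ b ∈ B, p ^ i • b = p ^ i • m + c}
  obtain ⟨C, hC⟩ : ∃ C, Maximal (· ∈ s) C := by
    apply zorn_le₀
    intro c hcs hc
    rcases c.eq_empty_or_nonempty with rfl | hne
    · refine ⟨⊥, ?_, by simp⟩
      intro i m c hc hB
      rw [AddSubgroup.mem_bot] at hc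
      subst hc
      rw [add_zero] at hB ⊢
      exact hpure i m hB
    · refine ⟨sSup c, ?_, fun z hz => le_sSup hz⟩
      intro i m x hx hB
      obtain ⟨K, hK, hxK⟩ := (AddSubgroup.mem_sSup_of_isChain hc hne).mp hx
      exact hcs hK i m x hxK hB
  have hCs : C ∈ s := hC.1
  have hmax : ∀ x : M, C ⊔ AddSubgroup.zmultiples x ∈ s → x ∈ C := fun x hx =>
    hC.2 hx le_sup_left (le_sup_right (a := C) (AddSubgroup.mem_zmultiples x))
  -- Adjoining `p ^ N • m` keeps the property: for `i ≤ N` it is absorbed by `p ^ i • m'`, and for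
  -- `i ≥ N` the element of `B` is `p ^ N` times one of `B`, so zero.
  have hpN : ∀ m : M, p ^ N • m ∈ C := by
    intro m
    apply hmax
    intro i m' c hc hB
    obtain ⟨c', hc', y, hy, rfl⟩ := AddSubgroup.mem_sup.mp hc
    obtain ⟨k, rfl⟩ := AddSubgroup.mem_zmultiples_iff.mp hy
    rcases le_total i N with h | h
    · obtain ⟨d, rfl⟩ := Nat.exists_eq_add_of_le h
      have e : p ^ i • m' + (c' + k • p ^ (i + d) • m) = p ^ i • (m' + k • p ^ d • m) + c' := by
        rw [smul_add, smul_comm (p ^ i) k, ← mul_smul, ← pow_add]; abel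
      rw [e] at hB ⊢
      exact hCs _ _ _ hc' hB
    · obtain ⟨d, rfl⟩ := Nat.exists_eq_add_of_le h
      have e : p ^ (N + d) • m' + (c' + k • p ^ N • m) = p ^ N • (p ^ d • m' + k • m) + c' := by
        rw [smul_add, smul_comm (p ^ N) k, ← mul_smul, ← pow_add]; abel
      rw [e] at hB ⊢
      obtain ⟨b, hb, hb'⟩ := hCs _ _ _ hc' hB
      refine ⟨0, B.zero_mem, ?_⟩
      rw [← hb', hN b hb, smul_zero]
  have hdisj : ∀ x ∈ B, x ∈ C → x = 0 := by
    intro x hx hxC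
    obtain ⟨b, hb, hb'⟩ := hCs N 0 x hxC (by simpa using hx)
    rw [smul_zero, zero_add, hN b hb] at hb'
    exact hb'.symm
  refine ⟨C, IsCompl.of_eq ?_ ?_⟩
  · rw [eq_bot_iff]
    rintro x ⟨hx, hx'⟩
    exact hdisj x hx hx'
  by_contra hne
  obtain ⟨x, hx⟩ : ∃ x, x ∉ B ⊔ C := by
    by_contra! h
    exact hne (eq_top_iff.mpr fun x _ => h x)
  -- elements of order `p` modulo `C`, outside of `B ⊔ C`
  let P : ℕ → Prop := fun j => ∃ s, s ∉ B ⊔ C ∧ p • s ∈ C ∧ ∃ m, ∃ c ∈ C, s = p ^ j • m + c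
  -- The last multiple `p ^ e • x` outside `B ⊔ C`, corrected by an element of `B`, has order `p`
  -- modulo `C`.
  have hP0 : P 0 := by
    have hex : ∃ e, p ^ e • x ∈ B ⊔ C := ⟨N, le_sup_right (a := B) (hpN x)⟩
    classical
    have he := Nat.find_spec hex
    have hmin := fun m => Nat.find_min (m := m) hex
    generalize Nat.find hex = e at he hmin
    rcases e with _ | e
    · exact absurd (by simpa using he) hx
    have hx' := hmin e (Nat.lt_succ_self e)
    obtain ⟨b, hb, c, hc, hbc⟩ := AddSubgroup.mem_sup.mp he
    rw [pow_succ', mul_smul] at hbc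
    have e1 : p ^ 1 • p ^ e • x + -c = b := by rw [pow_one, ← hbc]; abel
    obtain ⟨b', hb', e2⟩ := hCs 1 (p ^ e • x) (-c) (C.neg_mem hc) (by rw [e1]; exact hb)
    refine ⟨p ^ e • x - b', fun h => hx' ?_, ?_, p ^ e • x - b', 0, C.zero_mem, by simp⟩
    · have := (B ⊔ C).add_mem h (le_sup_left (b := C) hb')
      rwa [sub_add_cancel] at this
    · rw [e1, pow_one] at e2
      rw [smul_sub, ← hbc, e2, add_sub_cancel_left]
      exact hc
  have hPN : ∀ j, P j → j ≤ N := by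
    rintro j ⟨s, hs, -, m, c, hc, rfl⟩
    by_contra! h
    obtain ⟨d, rfl⟩ := Nat.exists_eq_add_of_le h.le
    refine hs (le_sup_right (a := B) (C.add_mem ?_ hc))
    rw [pow_add, mul_smul]
    exact hpN _
  classical
  have hj := Nat.findGreatest_spec (P := P) (Nat.zero_le N) hP0
  have hjmax : ∀ i, P i → i ≤ Nat.findGreatest P N := fun i hi =>
    Nat.le_findGreatest (hPN i hi) hi
  generalize Nat.findGreatest P N = j at hj hjmax
  obtain ⟨s, hs, hps, m₀, c₀, hc₀, hsm⟩ := hj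
  refine hs (le_sup_right (a := B) (hmax s ?_))
  intro i m c hc hB
  obtain ⟨c', hc', y, hy, rfl⟩ := AddSubgroup.mem_sup.mp hc
  obtain ⟨a, rfl⟩ := AddSubgroup.mem_zmultiples_iff.mp hy
  by_cases hpa : (p : ℤ) ∣ a
  · obtain ⟨k, rfl⟩ := hpa
    refine hCs i m _ (C.add_mem hc' ?_) hB
    rw [mul_comm, mul_smul, natCast_zsmul]
    exact C.zsmul_mem hps k
  · obtain ⟨u, v, huv⟩ := Int.isCoprime_prime_pow hp hpa 1
    -- Subtracting an element of `B` from `s` gives another witness of `P`, of height at least `i`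
    -- modulo `C`; `j` is maximal.
    have hle : i ≤ j := by
      apply hjmax
      set b := p ^ i • m + (c' + a • s) with hb
      have hsu : s = u • b - p ^ i • u • m - u • c' + v • p • s := by
        have : s = (u * a + v * (p : ℤ) ^ 1) • s := by rw [huv, one_smul]
        rw [hb, smul_add, smul_add, smul_comm u (p ^ i) m]
        nth_rewrite 1 [this]
        rw [pow_one, add_smul, mul_smul, mul_smul, natCast_zsmul]
        abel
      have hpb : p ^ (i + 1) • u • m + (p • u • c' + (a * u) • p • s) = p • u • b := by
        rw [hb, smul_add u, smul_add u, smul_add p, smul_add p, pow_succ', mul_smul, mul_comm a u,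
          mul_smul, smul_comm p u (a • s), smul_comm p a s, smul_comm u (p ^ i) m]
      obtain ⟨b', hb', e⟩ := hCs (i + 1) (u • m) (p • u • c' + (a * u) • p • s)
        (C.add_mem (C.nsmul_mem (C.zsmul_mem hc' _) _) (C.zsmul_mem hps _))
        (by rw [hpb]; exact B.nsmul_mem (B.zsmul_mem hB u) p)
      rw [hpb] at e
      have hb2 : u • b - p ^ i • b' ∈ B := B.sub_mem (B.zsmul_mem hB u) (B.nsmul_mem hb' _)
      refine ⟨s - (u • b - p ^ i • b'), fun h => hs ?_, ?_, b' - u • m, - (u • c') + v • p • s,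
        C.add_mem (C.neg_mem (C.zsmul_mem hc' u)) (C.zsmul_mem hps v), ?_⟩
      · have := (B ⊔ C).add_mem h (le_sup_left (b := C) hb2)
        rwa [sub_add_cancel] at this
      · rw [smul_sub, smul_sub, ← e, pow_succ', mul_smul, sub_self, sub_zero]
        exact hps
      · nth_rewrite 1 [hsu]
        rw [smul_sub]
        abel
    obtain ⟨d, rfl⟩ := Nat.exists_eq_add_of_le hle
    have e : p ^ i • m + (c' + a • s) = p ^ i • (m + a • p ^ d • m₀) + (c' + a • c₀) := by
      rw [hsm, smul_add, smul_add, pow_add, mul_smul, smul_comm a (p ^ i)]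
      abel
    rw [e] at hB ⊢
    exact hCs i _ _ (C.add_mem hc' (C.zsmul_mem hc₀ a)) hB

/-- The divisible group `D = p ^ N B` splits off. What remains of `B` in its complement `M₁` is pure
and killed by `p ^ N`, and the modular law cuts a complement of it down to `M₁`. -/
theorem AddSubgroup.exists_isCompl_of_pure_of_divisible {M : Type*} [AddCommGroup M] {p : ℕ}
    (hp : p.Prime) (B : AddSubgroup M) (htor : ∀ x ∈ B, ∃ e : ℕ, p ^ e • x = 0) (N : ℕ)
    (hN : ∀ b ∈ B, ∃ b' ∈ B, p ^ (N + 1) • b' = p ^ N • b)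
    (hpure : ∀ (i : ℕ) (m : M), p ^ i • m ∈ B → ∃ b ∈ B, p ^ i • b = p ^ i • m) :
    ∃ C, IsCompl B C := by
  let D : AddSubgroup M := B.map (nsmulAddMonoidHom (p ^ N))
  have hDB : D ≤ B := by
    rintro _ ⟨b, hb, rfl⟩
    exact B.nsmul_mem hb _
  obtain ⟨M₁, hM₁⟩ := AddSubgroup.exists_isCompl_of_prime_divisible hp D
    (fun x hx => htor x (hDB hx)) (by
      rintro _ ⟨b, hb, rfl⟩
      obtain ⟨b', hb', e⟩ := hN b hb
      refine ⟨p ^ N • b', ⟨b', hb', rfl⟩, ?_⟩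
      rw [← mul_smul, ← pow_succ', e]
      rfl)
  obtain ⟨C', hC'⟩ := AddSubgroup.exists_isCompl_of_pure_of_bounded hp (B ⊓ M₁) N
    (by
      rintro b ⟨hb, hb'⟩
      exact AddSubgroup.isCompl_mem_eq_zero hM₁ ⟨b, hb, rfl⟩ (M₁.nsmul_mem hb' _))
    (by
      rintro i m ⟨hB, hM⟩
      obtain ⟨b, hb, e⟩ := hpure i m hB
      obtain ⟨d, hd, b', hb', rfl⟩ := AddSubgroup.isCompl_exists_add hM₁ b
      have hb'B : b' ∈ B := by
        have := B.sub_mem hb (hDB hd)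
        rwa [add_sub_cancel_left] at this
      refine ⟨b', ⟨hb'B, hb'⟩, ?_⟩
      rw [smul_add] at e
      have h0 : p ^ i • d = 0 := by
        refine AddSubgroup.isCompl_mem_eq_zero hM₁ (D.nsmul_mem hd _) ?_
        have := M₁.sub_mem (e ▸ hM) (M₁.nsmul_mem hb' (p ^ i))
        rwa [add_sub_cancel_right] at this
      rw [← e, h0, zero_add])
  refine ⟨C' ⊓ M₁, IsCompl.of_eq ?_ ?_⟩
  · rw [inf_comm C', ← inf_assoc]
    exact hC'.inf_eq_bot
  · have h1 : B ⊓ M₁ ⊔ C' ⊓ M₁ = M₁ := by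
      rw [← sup_inf_assoc_of_le C' (inf_le_right : B ⊓ M₁ ≤ M₁), hC'.sup_eq_top, top_inf_eq]
    rw [eq_top_iff, ← hM₁.sup_eq_top]
    refine sup_le (hDB.trans le_sup_left) ?_
    nth_rewrite 1 [← h1]
    exact sup_le_sup inf_le_left le_rfl

/-! ### The condition at a prime and two obstructions -/

/-- The condition at the prime `p` that characterizes semi-generalized co-Bassian groups of finite
torsion-free rank. The first part says that a socle of infinite size can only occur at a height up
to which all elements of `pG` of order `p` reach; the second part says that, if there are
infinitely many elements of order `p`, either the `p`-torsion is divisible or the quotient by the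
`p`-torsion is `p`-divisible. -/
def PrimeCondition (p : ℕ) (G : Type*) [AddCommGroup G] : Prop :=
  (∀ k, 1 ≤ k → {x : G | p • x = 0 ∧ ∃ g, p ^ k • g = x}.Finite ∨
    ∀ g : G, p • p • g = 0 → ∃ g', p ^ k • g' = p • g) ∧
  ({x : G | p • x = 0}.Finite ∨ (∀ t : G, (∃ e : ℕ, p ^ e • t = 0) → ∃ g, p • g = t) ∨
    ∀ g : G, ∃ t g', (∃ e : ℕ, p ^ e • t = 0) ∧ g = t + p • g')

theorem IsEssentialIn.mem_of_prime_smul_eq_zero {A : Type*} [AddCommGroup A] {H S : AddSubgroup A}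
    (h : IsEssentialIn H S) {p : ℕ} (hp : p.Prime) {s : A} (hs : s ∈ S) (hps : p • s = 0) :
    s ∈ H := by
  by_cases h0 : s = 0
  · rw [h0]; exact H.zero_mem
  have h1 := h.2 (AddSubgroup.zmultiples s) (by simpa using hs)
    (by simpa [AddSubgroup.zmultiples_eq_bot] using h0)
  obtain ⟨⟨x, hx⟩, hx0⟩ := AddSubgroup.ne_bot_iff_exists_ne_zero.mp h1
  obtain ⟨hxH, hxs⟩ := hx
  obtain ⟨n, rfl⟩ := AddSubgroup.mem_zmultiples_iff.mp hxs
  have hn : ¬ (p : ℤ) ∣ n := by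
    rintro ⟨k, rfl⟩
    apply hx0
    rw [Subtype.ext_iff]
    change (p * k) • s = 0
    rw [mul_comm, mul_smul, natCast_zsmul, hps, smul_zero]
  obtain ⟨k, hk⟩ := exists_zsmul_eq_of_coprime (Int.isCoprime_prime_pow hp hn 1)
    (a := s) (by simpa using hps)
  rw [smul_comm] at hk
  rw [← hk]
  exact H.zsmul_mem hxH k

/-- The form used for refutations: quotients become surjections, and of essentiality only the
consequence for elements of prime order is kept. -/
theorem IsSemiGenCoBassian.exists_of_surjective {G A : Type*} [AddCommGroup G] [AddCommGroup A]
    (h : IsSemiGenCoBassian G) (σ φ : G →+ A) (hσ : Function.Surjective σ)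
    (hφ : Function.Injective φ) :
    ∃ S C : AddSubgroup A, IsCompl S C ∧ (∀ g, φ g ∈ S) ∧
      ∀ p : ℕ, p.Prime → ∀ s ∈ S, p • s = 0 → ∃ g, φ g = s := by
  let e : G ⧸ σ.ker ≃+ A := QuotientAddGroup.quotientKerEquivOfSurjective σ hσ
  obtain ⟨S, ⟨C, hSC⟩, hS⟩ := h σ.ker (e.symm.toAddMonoidHom.comp φ)
    (e.symm.injective.comp hφ)
  refine ⟨S.comap e.symm.toAddMonoidHom, C.comap e.symm.toAddMonoidHom, IsCompl.of_eq ?_ ?_,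
    fun g => hS.1 ⟨g, rfl⟩, fun p hp s hs hps => ?_⟩
  · rw [eq_bot_iff]
    rintro x ⟨hx, hx'⟩
    have := AddSubgroup.isCompl_mem_eq_zero hSC hx hx'
    exact (AddEquiv.map_eq_zero_iff e.symm).mp this
  · rw [eq_top_iff]
    rintro x -
    obtain ⟨s, hs, c, hc, hx⟩ := AddSubgroup.isCompl_exists_add hSC (e.symm x)
    refine AddSubgroup.mem_sup.mpr ⟨e s, ?_, e c, ?_, ?_⟩
    · simpa using hs
    · simpa using hc
    · rw [← map_add, hx, e.apply_symm_apply]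
  · obtain ⟨g, hg⟩ := hS.mem_of_prime_smul_eq_zero hp (s := e.symm s) hs
      (by rw [← map_nsmul, hps, map_zero])
    exact ⟨g, e.symm.injective hg⟩

/-- If `x` generates a cyclic summand of order `p ^ m` with `2 ≤ m` and there is an embedding of `G`
into the other summand of a quotient that maps `x` to a multiple of `p`, then `G` is not
semi-generalized co-Bassian. -/
theorem not_isSemiGenCoBassian_of_embedding {G A : Type*} [AddCommGroup G] [AddCommGroup A]
    {p m : ℕ} (hp : p.Prime) (hm : 2 ≤ m) (χ : G →+ ZMod (p ^ m)) (σ ψ : G →+ A)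
    (hσ : Function.Surjective (χ.prod σ)) (hψ : Function.Injective ψ) (x : G) (hx : χ x = 1)
    (hpx : ∃ a, p • a = ψ x) : ¬ IsSemiGenCoBassian G := by
  intro h
  have : Fact p.Prime := ⟨hp⟩
  have hdvd : p ∣ p ^ m := dvd_pow_self p (by omega)
  let r : ZMod (p ^ m) →+ ZMod p := (ZMod.castHom hdvd (ZMod p)).toAddMonoidHom
  -- Elements killed by `p` are multiples of `p ^ (m - 1)`, hence of `p`, because `2 ≤ m`.
  have hr : ∀ z : ZMod (p ^ m), p • z = 0 → r z = 0 := by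
    intro z hz
    have : NeZero (p ^ m) := ⟨(pow_pos hp.pos m).ne'⟩
    obtain ⟨n, rfl⟩ := ZMod.natCast_zmod_surjective z
    rw [nsmul_eq_mul, ← Nat.cast_mul, ZMod.natCast_eq_zero_iff] at hz
    change ZMod.castHom hdvd (ZMod p) (n : ZMod (p ^ m)) = 0
    rw [map_natCast, ZMod.natCast_eq_zero_iff]
    have h2 : p * p ∣ p * n := dvd_trans (by rw [← sq]; exact pow_dvd_pow p hm) hz
    exact Nat.dvd_of_mul_dvd_mul_left hp.pos h2
  have hrs : Function.Surjective r := ZMod.castHom_surjective hdvd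
  obtain ⟨S, C, hSC, hS, hess⟩ := h.exists_of_surjective (A := ZMod p × A) ((r.comp χ).prod σ)
    ((r.comp χ).prod ψ)
    (by
      rintro ⟨u, a⟩
      obtain ⟨v, rfl⟩ := hrs u
      obtain ⟨g, hg⟩ := hσ (v, a)
      rw [AddMonoidHom.prod_apply, Prod.mk.injEq] at hg
      exact ⟨g, by simp [hg.1, hg.2]⟩)
    (fun a b hab => hψ (congrArg Prod.snd hab))
  obtain ⟨π, hπS, hπC, hπ, hπ'⟩ := AddSubgroup.exists_projection_of_isCompl hSC
  obtain ⟨d, hd⟩ := hpx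
  have hpz : ∀ z : ZMod p × A, (p • z).1 = 0 := fun z => by simp
  -- Modulo the image, `(1, 0)` is a multiple of `p`, and such multiples have first coordinate zero
  -- in `ℤ/p × A`. So the `C`-component of `(1, 0)` has first coordinate `0` and its `S`-component,
  -- of order `p`, has first coordinate `1`.
  have e1 : ((1, 0) : ZMod p × A) = p • (0, -d) + ((r.comp χ).prod ψ) x := by
    have hr1 : r 1 = 1 := map_one (ZMod.castHom hdvd (ZMod p))
    simp [hx, ← hd, hr1]
  have e2 : (π (1, 0)).1 = 0 := by
    rw [e1, map_add, hπS _ (hS x), add_zero, map_nsmul]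
    exact hpz _
  have hp1 : p • ((1, 0) : ZMod p × A) = 0 := by simp
  obtain ⟨g, hg⟩ := hess p hp ((1, 0) - π (1, 0)) (hπ' _)
    (by rw [smul_sub, ← map_nsmul, hp1, map_zero, sub_zero])
  have hpg : p • g = 0 := by
    apply hψ
    have : p • ((r.comp χ).prod ψ) g = 0 := by
      rw [hg, smul_sub, ← map_nsmul, hp1, map_zero, sub_zero]
    rw [map_nsmul, map_zero]
    exact congrArg Prod.snd this
  have e3 : r (χ g) = 0 := hr _ (by rw [← map_nsmul, hpg, map_zero])
  have e4 := congrArg Prod.fst hg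
  simp [e3, e2] at e4

theorem exists_hom_zmod_ne_zero_of_exponent {V : Type*} [AddCommGroup V] {p : ℕ} (hp : p.Prime)
    (hV : ∀ v : V, p • v = 0) {v : V} (hv : v ≠ 0) : ∃ f : V →+ ZMod p, f v ≠ 0 := by
  have : Fact p.Prime := ⟨hp⟩
  have key : ∀ _ : Module (ZMod p) V, ∃ f : V →+ ZMod p, f v ≠ 0 := by
    intro _
    obtain ⟨f, hf⟩ := Module.Projective.exists_dual_ne_zero (ZMod p) hv
    exact ⟨f.toAddMonoidHom, hf⟩
  exact key (AddCommGroup.zmodModule hV)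

theorem exists_hom_zmod_ne_zero {G : Type*} [AddCommGroup G] {p : ℕ} (hp : p.Prime)
    (L : AddSubgroup G) (hL : ∀ g : G, p • g ∈ L) {g : G} (hg : g ∉ L) :
    ∃ f : G →+ ZMod p, (∀ l ∈ L, f l = 0) ∧ f g ≠ 0 := by
  obtain ⟨f, hf⟩ := exists_hom_zmod_ne_zero_of_exponent hp (V := G ⧸ L) (by
    intro x
    obtain ⟨y, rfl⟩ := QuotientAddGroup.mk_surjective x
    rw [← QuotientAddGroup.mk_nsmul]
    exact (QuotientAddGroup.eq_zero_iff _).mpr (hL y))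
    (v := (g : G ⧸ L)) (fun h => hg ((QuotientAddGroup.eq_zero_iff _).mp h))
  refine ⟨f.comp (QuotientAddGroup.mk' L), fun l hl => ?_, hf⟩
  have : QuotientAddGroup.mk' L l = 0 := (QuotientAddGroup.eq_zero_iff _).mpr hl
  rw [AddMonoidHom.comp_apply, this, map_zero]

/-- The second obstruction: a quotient `ℤ/p^m × A` into which `G` embeds inside `A`, an injective
endomorphism that fixes the `p`-torsion and is divisible by `p ^ m` modulo it, and an element that
is not divisible by `p` modulo the `p`-torsion. -/
theorem not_isSemiGenCoBassian_of_endomorphism {G A : Type*} [AddCommGroup G] [AddCommGroup A]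
    {p m : ℕ} (hp : p.Prime) (hm : 1 ≤ m) (χ : G →+ ZMod (p ^ m)) (σ ψ : G →+ A)
    (hσ : Function.Surjective (χ.prod σ)) (hψ : Function.Injective ψ) (ε : G →+ G)
    (hε : Function.Injective ε) (hεT : ∀ t, (∃ e : ℕ, p ^ e • t = 0) → ε t = t)
    (hεm : ∀ g, ∃ t g', (∃ e : ℕ, p ^ e • t = 0) ∧ ε g = t + p ^ m • g')
    (g₀ : G) (hg₀ : ∀ t g', (∃ e : ℕ, p ^ e • t = 0) → g₀ ≠ t + p • g') :
    ¬ IsSemiGenCoBassian G := by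
  intro h
  let L : AddSubgroup G :=
    { carrier := {g | ∃ t g', (∃ e : ℕ, p ^ e • t = 0) ∧ g = t + p • g'}
      zero_mem' := ⟨0, 0, ⟨0, by simp⟩, by simp⟩
      add_mem' := by
        rintro _ _ ⟨t, g, ⟨e, he⟩, rfl⟩ ⟨t', g', ⟨e', he'⟩, rfl⟩
        refine ⟨t + t', g + g', ⟨e + e', ?_⟩, by rw [smul_add]; abel⟩
        rw [smul_add, pow_add, mul_smul, mul_smul, he', smul_comm, he]
        simp
      neg_mem' := by
        rintro _ ⟨t, g, ⟨e, he⟩, rfl⟩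
        exact ⟨-t, -g, ⟨e, by rw [smul_neg, he, neg_zero]⟩, by rw [smul_neg]; abel⟩ }
  have hTL : ∀ t, (∃ e : ℕ, p ^ e • t = 0) → t ∈ L := fun t ht => ⟨t, 0, ht, by simp⟩
  obtain ⟨f₀, hf₀, hf₀g⟩ := exists_hom_zmod_ne_zero hp L (fun g => ⟨0, g, ⟨0, by simp⟩, by simp⟩)
    (g := g₀) (by rintro ⟨t, g', ht, hg⟩; exact hg₀ t g' ht hg)
  -- Multiplication by `p ^ (m - 1)` identifies `ℤ/p` with the socle of `ℤ/p^m`.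
  obtain ⟨ι, hι⟩ : ∃ ι : ZMod p →+ ZMod (p ^ m), Function.Injective ι := by
    refine ⟨ZMod.lift p ⟨zmultiplesHom _ ((p ^ (m - 1) : ℕ) : ZMod (p ^ m)), ?_⟩, ?_⟩
    · have : p * p ^ (m - 1) = p ^ m := by rw [← pow_succ', Nat.sub_add_cancel hm]
      simp only [zmultiplesHom_apply, zsmul_eq_mul, Int.cast_natCast]
      rw [← Nat.cast_mul, this, ZMod.natCast_self]
    · rw [ZMod.lift_injective]
      intro k hk
      simp only [zmultiplesHom_apply, zsmul_eq_mul] at hk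
      have h2 : ((k * (p ^ (m - 1) : ℕ) : ℤ) : ZMod (p ^ m)) = 0 := by exact_mod_cast hk
      rw [ZMod.intCast_zmod_eq_zero_iff_dvd] at h2
      have e : ((p ^ m : ℕ) : ℤ) = (p : ℤ) * (p ^ (m - 1) : ℕ) := by
        rw [← Nat.cast_mul, ← pow_succ', Nat.sub_add_cancel hm]
      rw [e] at h2
      have := Int.dvd_of_mul_dvd_mul_right
        (by exact_mod_cast (pow_pos hp.pos (m - 1)).ne') h2
      exact (ZMod.intCast_zmod_eq_zero_iff_dvd _ _).mpr this
  let f : G →+ ZMod (p ^ m) := ι.comp f₀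
  have hfT : ∀ t, (∃ e : ℕ, p ^ e • t = 0) → f t = 0 := fun t ht => by
    change ι (f₀ t) = 0
    rw [hf₀ t (hTL t ht), map_zero]
  have hfg : f g₀ ≠ 0 := fun h0 => hf₀g (hι (by rw [map_zero]; exact h0))
  have hpf : p • f g₀ = 0 := by
    change p • ι (f₀ g₀) = 0
    rw [← map_nsmul]
    simp
  obtain ⟨S, C, hSC, hS, hess⟩ := h.exists_of_surjective (A := ZMod (p ^ m) × A) (χ.prod σ)
    (f.prod (ψ.comp ε)) hσ (fun a b hab => hε (hψ (congrArg Prod.snd hab)))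
  obtain ⟨π, hπS, hπC, hπ, hπ'⟩ := AddSubgroup.exists_projection_of_isCompl hSC
  obtain ⟨t, g₁, ht, hg₁⟩ := hεm g₀
  -- Modulo the image, `(f g₀, 0)` is a multiple of `p ^ m`, which vanishes in `ℤ/p^m`. So its
  -- `S`-component has first coordinate `f g₀ ≠ 0` and is killed by `p`; but `f` vanishes on the
  -- `p`-torsion, from which all such elements of the image come.
  have e1 : ((f g₀, 0) : ZMod (p ^ m) × A) =
      (f.prod (ψ.comp ε)) g₀ - (f.prod (ψ.comp ε)) t - p ^ m • (0, ψ g₁) := by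
    simp [hg₁, hεT t ht, hfT t ht]
  have e2 : (π (f g₀, 0)).1 = 0 := by
    rw [e1, map_sub, map_sub, hπS _ (hS _), hπS _ (hS _), map_nsmul]
    simp only [sub_self, zero_sub, Prod.fst_neg, Prod.smul_fst, nsmul_eq_mul, ZMod.natCast_self,
      zero_mul, neg_zero]
  have hp1 : p • ((f g₀, 0) : ZMod (p ^ m) × A) = 0 := by
    rw [Prod.smul_mk, hpf, smul_zero]; rfl
  obtain ⟨g, hg⟩ := hess p hp ((f g₀, 0) - π (f g₀, 0)) (hπ' _)
    (by rw [smul_sub, ← map_nsmul, hp1, map_zero, sub_zero])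
  have hpg : p • g = 0 := by
    apply hε
    apply hψ
    have : p • (f.prod (ψ.comp ε)) g = 0 := by
      rw [hg, smul_sub, ← map_nsmul, hp1, map_zero, sub_zero]
    rw [map_nsmul, map_nsmul, map_zero, map_zero]
    exact congrArg Prod.snd this
  have e4 := congrArg Prod.fst hg
  simp only [AddMonoidHom.prod_apply, hfT g ⟨1, by simpa using hpg⟩, Prod.fst_sub, e2, sub_zero]
    at e4
  exact hfg e4.symm

/-! ### Maps out of direct sums of cyclic groups -/

/-- The homomorphism `ℤ/n → M` that maps `1` to an element `z` with `n z = 0`. -/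
def zmodHom {M : Type*} [AddCommGroup M] (n : ℕ) (z : M) (h : n • z = 0) : ZMod n →+ M :=
  ZMod.lift n ⟨zmultiplesHom M z, by simpa using h⟩

theorem zmodHom_intCast {M : Type*} [AddCommGroup M] (n : ℕ) (z : M) (h : n • z = 0) (a : ℤ) :
    zmodHom n z h a = a • z := by
  simp [zmodHom, ZMod.lift_coe]

theorem zmodHom_one {M : Type*} [AddCommGroup M] (n : ℕ) (z : M) (h : n • z = 0) :
    zmodHom n z h 1 = z := by
  simpa using zmodHom_intCast n z h 1

/-- The homomorphism from a direct sum of cyclic groups given by elements of suitable order. -/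
def zmodSumHom {M : Type*} [AddCommGroup M] (n : ℕ → ℕ) (z : ℕ → M) (h : ∀ i, n i • z i = 0) :
    (Π₀ i, ZMod (n i)) →+ M :=
  DFinsupp.liftAddHom fun i => zmodHom (n i) (z i) (h i)

theorem zmodSumHom_single {M : Type*} [AddCommGroup M] (n : ℕ → ℕ) (z : ℕ → M)
    (h : ∀ i, n i • z i = 0) (i : ℕ) (a : ZMod (n i)) :
    zmodSumHom n z h (DFinsupp.single i a) = zmodHom (n i) (z i) (h i) a := by
  simp [zmodSumHom]

theorem ZMod.exists_of_prime_nsmul_eq_zero {p o : ℕ} (hp : p.Prime) (ho : 1 ≤ o)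
    (a : ZMod (p ^ o)) (ha : p • a = 0) : ∃ k : ℤ, a = ((k * p ^ (o - 1) : ℤ) : ZMod (p ^ o)) := by
  obtain ⟨b, rfl⟩ := ZMod.intCast_surjective a
  rw [nsmul_eq_mul] at ha
  have h2 : (((p : ℤ) * b : ℤ) : ZMod (p ^ o)) = 0 := by exact_mod_cast ha
  rw [ZMod.intCast_zmod_eq_zero_iff_dvd] at h2
  have e : ((p ^ o : ℕ) : ℤ) = (p : ℤ) * (p : ℤ) ^ (o - 1) := by
    rw [← pow_succ', Nat.sub_add_cancel ho]; norm_cast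
  rw [e] at h2
  obtain ⟨k, hk⟩ := Int.dvd_of_mul_dvd_mul_left (by exact_mod_cast hp.ne_zero) h2
  exact ⟨k, by rw [hk, mul_comm]⟩

theorem zmodHom_socle {M : Type*} [AddCommGroup M] {p o : ℕ} (z : M) (h : p ^ o • z = 0) (k : ℤ) :
    zmodHom (p ^ o) z h ((k * p ^ (o - 1) : ℤ) : ZMod (p ^ o)) = k • p ^ (o - 1) • z := by
  rw [zmodHom_intCast, mul_smul, ← natCast_zsmul]
  norm_cast

theorem ZMod.intCast_mul_pow_eq_zero {p o : ℕ} (ho : 1 ≤ o) {k : ℤ} (hk : (p : ℤ) ∣ k) :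
    ((k * p ^ (o - 1) : ℤ) : ZMod (p ^ o)) = 0 := by
  rw [ZMod.intCast_zmod_eq_zero_iff_dvd]
  have e : ((p ^ o : ℕ) : ℤ) = (p : ℤ) * (p : ℤ) ^ (o - 1) := by
    rw [← pow_succ', Nat.sub_add_cancel ho]; norm_cast
  rw [e]
  exact mul_dvd_mul_right hk _

theorem AddSubgroup.mem_of_coprime_zsmul_mem {M : Type*} [AddCommGroup M] (F : AddSubgroup M)
    {p : ℕ} (hp : p.Prime) {v : M} (hv : p • v ∈ F) {k : ℤ} (hk : ¬ (p : ℤ) ∣ k)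
    (hkv : k • v ∈ F) : v ∈ F := by
  obtain ⟨a, b, hab⟩ := Int.isCoprime_prime_pow hp hk 1
  have : v = a • k • v + b • p • v := by
    rw [← natCast_zsmul, ← mul_smul, ← mul_smul, ← add_smul]
    rw [pow_one] at hab
    rw [hab, one_smul]
  rw [this]
  exact F.add_mem (F.zsmul_mem hkv a) (F.zsmul_mem hv b)

/-- If `x ≠ 0`, let `i` be its last non-zero coordinate. The value of `x` and all earlier terms lie
in `F i`, so a multiple of `p ^ (o i - 1) • z i` by an integer prime to `p` does too, which `hz'`
excludes. -/
theorem zmodSumHom_eq_zero_of_socle {M : Type*} [AddCommGroup M] {p : ℕ} (hp : p.Prime)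
    (o : ℕ → ℕ) (ho : ∀ i, 1 ≤ o i) (z : ℕ → M) (h : ∀ i, p ^ o i • z i = 0)
    (F : ℕ → AddSubgroup M) (hF : Monotone F) (hz : ∀ i, p ^ (o i - 1) • z i ∈ F (i + 1))
    (hz' : ∀ i, p ^ (o i - 1) • z i ∉ F i) (x : Π₀ i, ZMod (p ^ o i)) (hx : p • x = 0)
    (hx0 : zmodSumHom (fun i => p ^ o i) z h x ∈ F 0) : x = 0 := by
  classical
  by_contra hne
  have hsupp : x.support.Nonempty := by
    rw [Finset.nonempty_iff_ne_empty]
    simpa using hne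
  have hsoc : ∀ i, ∃ k : ℤ, x i = ((k * p ^ (o i - 1) : ℤ) : ZMod (p ^ o i)) := fun i =>
    ZMod.exists_of_prime_nsmul_eq_zero hp (ho i) _ (by
      have := DFunLike.congr_fun hx i
      simpa using this)
  choose k hk using hsoc
  let i := x.support.max' hsupp
  have hi : i ∈ x.support := Finset.max'_mem _ _
  have hterm : ∀ j, zmodHom (p ^ o j) (z j) (h j) (x j) = k j • p ^ (o j - 1) • z j := fun j => by
    rw [hk j, zmodHom_socle]
  have hsum : zmodSumHom (fun i => p ^ o i) z h x =
      ∑ j ∈ x.support, zmodHom (p ^ o j) (z j) (h j) (x j) := by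
    rw [zmodSumHom, DFinsupp.liftAddHom_apply, DFinsupp.sumAddHom_apply]
    rfl
  rw [hsum, ← Finset.add_sum_erase _ _ hi] at hx0
  have hrest : ∑ j ∈ x.support.erase i, zmodHom (p ^ o j) (z j) (h j) (x j) ∈ F i := by
    refine AddSubgroup.sum_mem _ fun j hj => ?_
    rw [hterm]
    have hji : j < i := lt_of_le_of_ne (Finset.le_max' _ _ (Finset.mem_of_mem_erase hj))
      (Finset.ne_of_mem_erase hj)
    exact (F i).zsmul_mem (hF hji (hz j)) _
  have h1 : k i • p ^ (o i - 1) • z i ∈ F i := by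
    have := (F i).sub_mem (hF (Nat.zero_le i) hx0) hrest
    rwa [add_sub_cancel_right, hterm] at this
  have hki : ¬ (p : ℤ) ∣ k i := by
    intro hd
    have : x i = 0 := by rw [hk i]; exact ZMod.intCast_mul_pow_eq_zero (ho i) hd
    exact (DFinsupp.mem_support_iff.mp hi) this
  refine hz' i ((F i).mem_of_coprime_zsmul_mem hp ?_ hki h1)
  rw [← mul_smul, ← pow_succ', Nat.sub_add_cancel (ho i), h i]
  exact (F i).zero_mem

theorem exists_pow_nsmul_eq_zero_dfinsupp {p : ℕ} (o : ℕ → ℕ) (x : Π₀ i, ZMod (p ^ o i)) :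
    ∃ e : ℕ, p ^ e • x = 0 := by
  classical
  induction x using DFinsupp.induction with
  | h0 => exact ⟨0, by simp⟩
  | ha i b f _ _ ih =>
    obtain ⟨e, he⟩ := ih
    refine ⟨e + o i, ?_⟩
    rw [smul_add, pow_add, mul_smul, mul_smul, smul_comm (p ^ e) (p ^ o i) f, he, smul_zero,
      add_zero]
    have : p ^ o i • DFinsupp.single i b = (0 : Π₀ i, ZMod (p ^ o i)) := by
      rw [← DFinsupp.single_smul]
      have : p ^ o i • b = 0 := by rw [nsmul_eq_mul, ZMod.natCast_self, zero_mul]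
      rw [this, DFinsupp.single_zero]
    rw [this, smul_zero]

theorem injective_of_socle {X M : Type*} [AddCommGroup X] [AddCommGroup M] {p : ℕ}
    (hX : ∀ x : X, ∃ e : ℕ, p ^ e • x = 0) (f : X →+ M)
    (hf : ∀ x, p • x = 0 → f x = 0 → x = 0) : Function.Injective f := by
  rw [injective_iff_map_eq_zero]
  intro x hx
  obtain ⟨e, he⟩ := hX x
  induction e with
  | zero => simpa using he
  | succ e ih =>
    refine ih (hf _ ?_ ?_)
    · rw [← mul_smul, ← pow_succ', he]
    · rw [map_nsmul, hx, smul_zero]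

theorem zmodSumHom_injective {M : Type*} [AddCommGroup M] {p : ℕ} (hp : p.Prime)
    (o : ℕ → ℕ) (ho : ∀ i, 1 ≤ o i) (z : ℕ → M) (h : ∀ i, p ^ o i • z i = 0)
    (F : ℕ → AddSubgroup M) (hF : Monotone F) (hz : ∀ i, p ^ (o i - 1) • z i ∈ F (i + 1))
    (hz' : ∀ i, p ^ (o i - 1) • z i ∉ F i) :
    Function.Injective (zmodSumHom (fun i => p ^ o i) z h) :=
  injective_of_socle (exists_pow_nsmul_eq_zero_dfinsupp o) _ fun x hx hx0 =>
    zmodSumHom_eq_zero_of_socle hp o ho z h F hF hz hz' x hx (hx0 ▸ (F 0).zero_mem)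

/-- Induction on the order of `p ^ i • m`: its multiple by `p ^ e` has order `p`, and subtracting
from `m` the element of `B` found for that multiple lowers the exponent. -/
theorem pure_of_socle {M : Type*} [AddCommGroup M] {p : ℕ} (B : AddSubgroup M)
    (hB : ∀ x ∈ B, ∃ e : ℕ, p ^ e • x = 0)
    (hsoc : ∀ (i : ℕ) (m : M), p ^ i • m ∈ B → p • p ^ i • m = 0 →
      ∃ b ∈ B, p ^ i • b = p ^ i • m) (i : ℕ) (m : M) (hm : p ^ i • m ∈ B) :
    ∃ b ∈ B, p ^ i • b = p ^ i • m := by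
  obtain ⟨e, he⟩ := hB _ hm
  induction e generalizing m with
  | zero => exact ⟨0, B.zero_mem, by simpa using he.symm⟩
  | succ e ih =>
    have e1 : p ^ e • p ^ i • m = p ^ (i + e) • m := by rw [← mul_smul, ← pow_add, add_comm]
    obtain ⟨b, hb, hb'⟩ := hsoc (i + e) m (e1 ▸ B.nsmul_mem hm _)
      (by rw [← e1, ← mul_smul, ← pow_succ', he])
    have e2 : p ^ i • (m - b) = p ^ i • m - p ^ i • b := smul_sub _ _ _
    obtain ⟨b', hb'', e3⟩ := ih (m - b) (e2 ▸ B.sub_mem hm (B.nsmul_mem hb _)) (by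
      rw [e2, smul_sub, e1, ← hb', pow_add, mul_comm, mul_smul, sub_self])
    exact ⟨b' + b, B.add_mem hb'' hb, by rw [smul_add, e3, e2, sub_add_cancel]⟩

theorem exists_retraction_of_isCompl {X M : Type*} [AddCommGroup X] [AddCommGroup M] (j : X →+ M)
    (hj : Function.Injective j) {C : AddSubgroup M} (hC : IsCompl j.range C) :
    ∃ r : M →+ X, ∀ x, r (j x) = x := by
  obtain ⟨π, -, hπ, hπr, -⟩ := AddSubgroup.exists_projection_of_isCompl hC.symm
  refine ⟨(AddMonoidHom.ofInjective hj).symm.toAddMonoidHom.comp (π.codRestrict j.range hπr),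
    fun x => ?_⟩
  change (AddMonoidHom.ofInjective hj).symm (π.codRestrict j.range hπr (j x)) = x
  rw [AddEquiv.symm_apply_eq]
  exact Subtype.ext (hπ _ ⟨x, rfl⟩)

theorem exists_retraction_of_socle {X M : Type*} [AddCommGroup X] [AddCommGroup M] {p : ℕ}
    (hp : p.Prime) (j : X →+ M) (hj : Function.Injective j) (N : ℕ) (hN : ∀ x : X, p ^ N • x = 0)
    (hsoc : ∀ (i : ℕ) (x : X) (m : M), p • x = 0 → p ^ i • m = j x → ∃ x', p ^ i • x' = x) :
    ∃ r : M →+ X, ∀ x, r (j x) = x := by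
  have hN' : ∀ b ∈ j.range, p ^ N • b = 0 := by
    rintro _ ⟨x, rfl⟩
    rw [← map_nsmul, hN, map_zero]
  obtain ⟨C, hC⟩ := AddSubgroup.exists_isCompl_of_pure_of_bounded hp j.range N hN'
    (pure_of_socle _ (fun x hx => ⟨N, hN' x hx⟩) (by
      rintro i m ⟨x, hx⟩ hpm
      obtain ⟨x', hx'⟩ := hsoc i x m (hj (by rw [map_nsmul, hx, hpm, map_zero])) hx.symm
      exact ⟨j x', ⟨x', rfl⟩, by rw [← map_nsmul, hx', hx]⟩))
  exact exists_retraction_of_isCompl j hj hC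

theorem exists_increasing_finite_subgroups {M : Type*} [AddCommGroup M] {p : ℕ} (hp : p.Prime)
    (V : ℕ → Set M) (hVp : ∀ i, ∀ v ∈ V i, p • v = 0) (hV : ∀ i, (V i).Infinite)
    (W : AddSubgroup M) (hW : (W : Set M).Finite) :
    ∃ (F : ℕ → AddSubgroup M) (v : ℕ → M), F 0 = W ∧ Monotone F ∧ (∀ i, v i ∈ V i) ∧
      (∀ i, v i ∈ F (i + 1)) ∧ ∀ i, v i ∉ F i := by
  have hex : ∀ (i : ℕ) (F : {F : AddSubgroup M // (F : Set M).Finite}), ∃ v ∈ V i, v ∉ F.1 :=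
    fun i F => (hV i).exists_notMem_finite F.2
  choose f hf hf' using hex
  have hfin : ∀ (i : ℕ) (F : {F : AddSubgroup M // (F : Set M).Finite}),
      ((F.1 ⊔ AddSubgroup.zmultiples (f i F) : AddSubgroup M) : Set M).Finite := by
    intro i F
    rw [AddSubgroup.add_normal]
    refine F.2.add ?_
    have : IsOfFinAddOrder (f i F) :=
      isOfFinAddOrder_iff_nsmul_eq_zero.mpr ⟨p, hp.pos, hVp i _ (hf i F)⟩
    exact finite_zmultiples.mpr this
  let G : ℕ → {F : AddSubgroup M // (F : Set M).Finite} := fun n =>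
    Nat.rec ⟨W, hW⟩ (fun i F => ⟨F.1 ⊔ AddSubgroup.zmultiples (f i F), hfin i F⟩) n
  refine ⟨fun i => (G i).1, fun i => f i (G i), rfl,
    monotone_nat_of_le_succ fun i => (le_sup_left : (G i).1 ≤ _), fun i => hf _ _, fun i => ?_,
    fun i => hf' _ _⟩
  exact (le_sup_right : AddSubgroup.zmultiples (f i (G i)) ≤ _) (AddSubgroup.mem_zmultiples _)

/-- The socle generator of `⟨c⟩` has height exactly `m - 1` in `G`, so `⟨c⟩` is pure of order `p ^
m`; `χ` is a retraction onto it. -/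
theorem exists_character_eq_one {G : Type*} [AddCommGroup G] {p m : ℕ} (hp : p.Prime) (hm : 1 ≤ m)
    (c : G) (hc : p ^ m • c = 0) (hy : ∀ g, p ^ m • g ≠ p ^ (m - 1) • c) :
    ∃ χ : G →+ ZMod (p ^ m), χ c = 1 := by
  have hpy : p • p ^ (m - 1) • c = 0 := by rw [← mul_smul, ← pow_succ', Nat.sub_add_cancel hm, hc]
  have hinj : Function.Injective (zmodHom (p ^ m) c hc) := by
    refine injective_of_socle (p := p) (fun x => ⟨m, ?_⟩) _ ?_
    · rw [nsmul_eq_mul, ZMod.natCast_self, zero_mul]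
    · intro x hx hx0
      obtain ⟨k, rfl⟩ := ZMod.exists_of_prime_nsmul_eq_zero hp hm x hx
      rw [zmodHom_socle] at hx0
      by_cases hk : (p : ℤ) ∣ k
      · exact ZMod.intCast_mul_pow_eq_zero hm hk
      · have := (⊥ : AddSubgroup G).mem_of_coprime_zsmul_mem hp (v := p ^ (m - 1) • c)
          (by simpa using hpy) hk (by simpa using hx0)
        exact absurd (by simpa using (AddSubgroup.mem_bot.mp this).symm) (hy 0)
  obtain ⟨χ, hχ⟩ := exists_retraction_of_socle hp (zmodHom (p ^ m) c hc) hinj m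
    (fun x => by rw [nsmul_eq_mul, ZMod.natCast_self, zero_mul]) (by
      intro i x g hx hg
      obtain ⟨k, rfl⟩ := ZMod.exists_of_prime_nsmul_eq_zero hp hm x hx
      by_cases hk : (p : ℤ) ∣ k
      · exact ⟨0, by rw [ZMod.intCast_mul_pow_eq_zero hm hk, smul_zero]⟩
      rcases le_or_gt i (m - 1) with hi | hi
      · refine ⟨((k * p ^ (m - 1 - i) : ℤ) : ZMod (p ^ m)), ?_⟩
        rw [nsmul_eq_mul]
        push_cast
        rw [mul_left_comm, ← pow_add, Nat.add_sub_cancel' hi]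
      · exfalso
        rw [zmodHom_socle] at hg
        obtain ⟨d, hd⟩ := Nat.exists_eq_add_of_le (show m ≤ i by omega)
        obtain ⟨g', hg'⟩ := (nsmulAddMonoidHom (α := G) (p ^ m)).range.mem_of_coprime_zsmul_mem hp
          (v := p ^ (m - 1) • c) (by rw [hpy]; exact AddSubgroup.zero_mem _) hk
          ⟨p ^ d • g, by rw [← hg, hd, pow_add, mul_smul]; rfl⟩
        exact hy g' hg')
  exact ⟨χ, by simpa [zmodHom_one] using hχ 1⟩

/-- After `c`, the socle generators are chosen one by one outside the finite subgroup spanned by `W`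
and the earlier ones. Index `0` is reserved for `c`, hence the shift by one. -/
theorem exists_zmodSumHom_socle {G : Type*} [AddCommGroup G] {p : ℕ} (hp : p.Prime)
    (o : ℕ → ℕ) (ho : ∀ i, 1 ≤ o i) (c : G) (hc : p ^ o 0 • c = 0) (W : AddSubgroup G)
    (hW : (W : Set G).Finite) (hcW : p ^ (o 0 - 1) • c ∉ W)
    (hinf : ∀ i, {v : G | p • v = 0 ∧ ∃ g, p ^ (o (i + 1) - 1) • g = v}.Infinite) :
    ∃ (z : ℕ → G) (h : ∀ i, p ^ o i • z i = 0), z 0 = c ∧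
      ∀ x, p • x = 0 → zmodSumHom (fun i => p ^ o i) z h x ∈ W → x = 0 := by
  have hsucc : ∀ i, ∀ g : G, p ^ o i • g = p • p ^ (o i - 1) • g := fun i g => by
    rw [← mul_smul, ← pow_succ', Nat.sub_add_cancel (ho i)]
  have hfin : ((W ⊔ AddSubgroup.zmultiples (p ^ (o 0 - 1) • c) : AddSubgroup G) : Set G).Finite := by
    rw [AddSubgroup.add_normal]
    refine hW.add (finite_zmultiples.mpr ?_)
    exact isOfFinAddOrder_iff_nsmul_eq_zero.mpr ⟨p, hp.pos, by rw [← hsucc, hc]⟩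
  obtain ⟨F, v, hF0, hF, hvV, hvF, hvF'⟩ := exists_increasing_finite_subgroups hp
    (fun i => {v : G | p • v = 0 ∧ ∃ g, p ^ (o (i + 1) - 1) • g = v}) (fun i v hv => hv.1) hinf _ hfin
  choose hpv z hz using hvV
  refine ⟨fun i => Nat.casesOn i c z, fun i => ?_, rfl, ?_⟩
  · cases i with
    | zero => exact hc
    | succ i =>
      rw [hsucc]
      exact (congrArg (p • ·) (hz i)).trans (hpv i)
  · refine zmodSumHom_eq_zero_of_socle hp o ho _ _ (fun i => Nat.casesOn i W F) ?_ ?_ ?_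
    · refine monotone_nat_of_le_succ fun i => ?_
      cases i with
      | zero => exact le_sup_left.trans hF0.ge
      | succ i => exact hF (Nat.le_succ i)
    · intro i
      cases i with
      | zero => exact hF0.ge (le_sup_right (a := W) (AddSubgroup.mem_zmultiples _))
      | succ i => exact (hz i).symm ▸ hvF i
    · intro i
      cases i with
      | zero => exact hcW
      | succ i => exact fun h => hvF' i ((hz i) ▸ h)

/-! ### Quotients `ℤ/p^m × A` with `G` embedded in `A` -/

/-- `D` is a countable direct sum of Prüfer groups inside `ℕ →₀ ℚ/ℤ`: `w i k` is `1 / p ^ k` in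
coordinate `i`, and `F i` consists of the elements supported below `i`. -/
theorem exists_divisible_sum {p : ℕ} (hp : p.Prime) :
    ∃ (D : Type) (_ : AddCommGroup D) (w : ℕ → ℕ → D) (F : ℕ → AddSubgroup D),
      (∀ i k, p • w i (k + 1) = w i k) ∧ (∀ i, w i 0 = 0) ∧ Monotone F ∧
      (∀ i, w i 1 ∈ F (i + 1)) ∧ (∀ i, w i 1 ∉ F i) ∧
      AddSubgroup.closure (Set.range fun ik : ℕ × ℕ => w ik.1 ik.2) = ⊤ := by
  let u : ℕ → AddCircle (1 : ℚ) := fun k => ((1 / (p : ℚ) ^ k : ℚ) : AddCircle (1 : ℚ))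
  have hp0 : (p : ℚ) ≠ 0 := by exact_mod_cast hp.ne_zero
  have hu : ∀ k, p • u (k + 1) = u k := fun k => by
    change p • ((1 / (p : ℚ) ^ (k + 1) : ℚ) : AddCircle (1 : ℚ)) = _
    rw [← AddCircle.coe_nsmul]
    congr 1
    rw [nsmul_eq_mul]
    field_simp
    ring
  have hu0 : u 0 = 0 := by
    change ((1 / (p : ℚ) ^ 0 : ℚ) : AddCircle (1 : ℚ)) = 0
    simp
  have hu1 : u 1 ≠ 0 := by
    change ((1 / (p : ℚ) ^ 1 : ℚ) : AddCircle (1 : ℚ)) ≠ 0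
    rw [Ne, AddCircle.coe_eq_zero_iff]
    rintro ⟨n, hn⟩
    rw [pow_one, eq_div_iff hp0] at hn
    have h1 : n * (p : ℤ) = 1 := by
      have : (n : ℚ) * p = 1 := by simpa using hn
      exact_mod_cast this
    have h2 : (p : ℤ) ∣ 1 := ⟨n, by rw [mul_comm, h1]⟩
    exact hp.ne_one (Nat.dvd_one.mp (by exact_mod_cast h2))
  let f : ℕ × ℕ → ℕ →₀ AddCircle (1 : ℚ) := fun ik => Finsupp.single ik.1 (u ik.2)
  let D : AddSubgroup (ℕ →₀ AddCircle (1 : ℚ)) := AddSubgroup.closure (Set.range f)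
  let w : ℕ → ℕ → D := fun i k => ⟨f (i, k), AddSubgroup.subset_closure ⟨(i, k), rfl⟩⟩
  let F : ℕ → AddSubgroup D := fun i =>
    { carrier := {d | ∀ j, i ≤ j → d.1 j = 0}
      zero_mem' := fun j _ => rfl
      add_mem' := fun {a b} ha hb j hj => by
        change a.1 j + b.1 j = 0
        rw [ha j hj, hb j hj, add_zero]
      neg_mem' := fun {a} ha j hj => by
        change - a.1 j = 0
        rw [ha j hj, neg_zero] }
  refine ⟨D, inferInstance, w, F, fun i k => Subtype.ext ?_, fun i => Subtype.ext ?_,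
    fun i i' h d hd j hj => hd j (h.trans hj), fun i j hj => ?_, fun i h => hu1 ?_, ?_⟩
  · change p • Finsupp.single i (u (k + 1)) = Finsupp.single i (u k)
    rw [Finsupp.smul_single, hu]
  · change Finsupp.single i (u 0) = 0
    rw [hu0, Finsupp.single_zero]
  · change Finsupp.single i (u 1) j = 0
    rw [Finsupp.single_apply, if_neg (by omega)]
  · have := h i le_rfl
    change Finsupp.single i (u 1) i = 0 at this
    rwa [Finsupp.single_eq_same] at this
  · have h1 := AddSubgroup.closure_closure_coe_preimage (k := Set.range f)
    rw [← h1]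
    congr 1
    ext d
    constructor
    · rintro ⟨ik, rfl⟩
      exact ⟨ik, rfl⟩
    · rintro ⟨ik, h⟩
      exact ⟨ik, Subtype.ext h⟩

/-- Since the quotient by the image of `j` is kept as a factor, surjectivity and injectivity only
have to be checked on that image. An infinite direct sum `X` has room for both `σ` and `δ`. -/
theorem surjective_prod_mk_and_injective_prod_mk {G X D : Type*} [AddCommGroup G] [AddCommGroup X]
    [AddCommGroup D] {n : ℕ} (j : X →+ G) (χ : G →+ ZMod n) (σ δ : G →+ D)
    (hχ : ∀ a, ∃ x, χ (j x) = a ∧ σ (j x) = 0) (hσ : ∀ d, ∃ x, σ (j x) = d)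
    (hδ : ∀ x, δ (j x) = 0 → j x = 0) :
    Function.Surjective (χ.prod (σ.prod (QuotientAddGroup.mk' j.range))) ∧
      Function.Injective (δ.prod (QuotientAddGroup.mk' j.range)) := by
  have hmk : ∀ x, (QuotientAddGroup.mk' j.range) (j x) = 0 := fun x =>
    (QuotientAddGroup.eq_zero_iff _).mpr ⟨x, rfl⟩
  constructor
  · rintro ⟨a, d, q⟩
    obtain ⟨g, rfl⟩ := QuotientAddGroup.mk'_surjective _ q
    obtain ⟨x, hx⟩ := hσ (d - σ g)
    obtain ⟨x', hx', hx''⟩ := hχ (a - χ g - χ (j x))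
    refine ⟨g + j x + j x', ?_⟩
    simp only [AddMonoidHom.prod_apply, map_add, hx, hx', hx'', hmk]
    refine Prod.ext ?_ (Prod.ext ?_ ?_) <;> simp
  · rw [injective_iff_map_eq_zero]
    intro g hg
    rw [AddMonoidHom.prod_apply, Prod.mk_eq_zero] at hg
    obtain ⟨x, rfl⟩ := (QuotientAddGroup.eq_zero_iff _).mp hg.2
    exact hδ x hg.1

/-- Elements of finite height and infinitely many elements of order `p` of arbitrarily large height
give a quotient `ℤ/p^m × A` of `G` such that `G` embeds in `A`. -/
theorem exists_embedding_of_infinite_socles.{u} {G : Type u} [AddCommGroup G] {p m : ℕ} (hp : p.Prime)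
    (hm : 1 ≤ m) (c : G) (hc : p ^ m • c = 0) (hy : ∀ g, p ^ m • g ≠ p ^ (m - 1) • c)
    (hinf : ∀ k, {x : G | p • x = 0 ∧ ∃ g, p ^ k • g = x}.Infinite) :
    ∃ (A : Type u) (_ : AddCommGroup A) (χ : G →+ ZMod (p ^ m)) (σ ψ : G →+ A),
      Function.Surjective (χ.prod σ) ∧ Function.Injective ψ ∧ χ c = 1 ∧ ∃ a, p • a = ψ c := by
  obtain ⟨χ, hχ⟩ := exists_character_eq_one hp hm c hc hy
  -- Unbounded orders `p, p², p³, …` after that of `c` make it possible to map the sum onto `D`.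
  let o : ℕ → ℕ := fun i => Nat.casesOn i m (fun i => i + 1)
  have ho : ∀ i, 1 ≤ o i := fun i => by
    cases i with
    | zero => exact hm
    | succ i => exact Nat.le_add_left 1 i
  obtain ⟨z, hz, hz0, hsoc⟩ := exists_zmodSumHom_socle hp o ho c hc ⊥ (by simp)
    (by
      rw [AddSubgroup.mem_bot]
      exact fun h => hy 0 (by rw [smul_zero]; exact h.symm))
    (fun i => hinf i)
  have hj : Function.Injective (zmodSumHom (fun i => p ^ o i) z hz) :=
    injective_of_socle (exists_pow_nsmul_eq_zero_dfinsupp o) _ fun x hx hx0 =>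
      hsoc x hx (AddSubgroup.mem_bot.mpr hx0)
  obtain ⟨D, _, w, F, hw, hw0, hF, hwF, hwF', hgen⟩ := exists_divisible_sum hp
  have hwpow : ∀ i a b, p ^ a • w i (b + a) = w i b := by
    intro i a
    induction a with
    | zero => intro b; simp
    | succ a ih => intro b; rw [pow_succ, mul_smul, ← add_assoc, hw, ih]
  have hwtor : ∀ i k, p ^ k • w i k = 0 := fun i k => by
    have := hwpow i k 0
    rwa [zero_add, hw0] at this
  have hD : ∀ n : ℤ, n ≠ 0 → ∀ a : D, ∃ b : D, n • b = a := by
    refine exists_zsmul_eq_of_prime_divisible hp (fun x => ?_) (fun x => ?_)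
    · have hx : x ∈ AddSubgroup.closure (Set.range fun ik : ℕ × ℕ => w ik.1 ik.2) := by
        rw [hgen]; trivial
      induction hx using AddSubgroup.closure_induction with
      | mem x hx => obtain ⟨ik, rfl⟩ := hx; exact ⟨ik.2, hwtor _ _⟩
      | zero => exact ⟨0, by simp⟩
      | add x y _ _ hx hy =>
        obtain ⟨e, he⟩ := hx
        obtain ⟨e', he'⟩ := hy
        exact ⟨e + e', by rw [smul_add, pow_add, mul_smul, mul_smul, he', smul_comm, he]; simp⟩
      | neg x _ hx => obtain ⟨e, he⟩ := hx; exact ⟨e, by rw [smul_neg, he, neg_zero]⟩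
    · have hx : x ∈ AddSubgroup.closure (Set.range fun ik : ℕ × ℕ => w ik.1 ik.2) := by
        rw [hgen]; trivial
      induction hx using AddSubgroup.closure_induction with
      | mem x hx => obtain ⟨ik, rfl⟩ := hx; exact ⟨w ik.1 (ik.2 + 1), hw _ _⟩
      | zero => exact ⟨0, by simp⟩
      | add x y _ _ hx hy =>
        obtain ⟨a, rfl⟩ := hx
        obtain ⟨b, rfl⟩ := hy
        exact ⟨a + b, smul_add _ _ _⟩
      | neg x _ hx => obtain ⟨a, rfl⟩ := hx; exact ⟨-a, smul_neg _ _⟩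
  have hδz : ∀ i, p ^ o i • w i (o i) = 0 := fun i => hwtor i (o i)
  have hδz1 : ∀ i, p ^ (o i - 1) • w i (o i) = w i 1 := fun i => by
    have := hwpow i (o i - 1) 1
    rwa [Nat.add_sub_cancel' (ho i)] at this
  have hδX : Function.Injective (zmodSumHom (fun i => p ^ o i) (fun i => w i (o i)) hδz) :=
    zmodSumHom_injective hp o ho _ hδz F hF (fun i => by rw [hδz1]; exact hwF i)
      (fun i => by rw [hδz1]; exact hwF' i)
  -- `c` goes to `0`, and the generator of order `p ^ (i + 1)` to `w a b` with `i = Nat.pair a b`;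
  -- as `b ≤ i`, its order suffices.
  let s : ℕ → D := fun i => Nat.casesOn i 0 fun i => w i.unpair.1 i.unpair.2
  have hs : ∀ i, p ^ o i • s i = 0 := fun i => by
    cases i with
    | zero => exact smul_zero _
    | succ i =>
      change p ^ (i + 1) • w i.unpair.1 i.unpair.2 = 0
      obtain ⟨d, hd⟩ := Nat.exists_eq_add_of_le ((Nat.unpair_right_le i).trans (Nat.le_succ i))
      rw [Nat.succ_eq_add_one] at hd
      rw [hd, add_comm, pow_add, mul_smul, hwtor, smul_zero]
  have hσX : ∀ d, ∃ x, zmodSumHom (fun i => p ^ o i) s hs x = d := by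
    intro d
    have hd : d ∈ (zmodSumHom (fun i => p ^ o i) s hs).range := by
      have : AddSubgroup.closure (Set.range fun ik : ℕ × ℕ => w ik.1 ik.2) ≤
          (zmodSumHom (fun i => p ^ o i) s hs).range := by
        rw [AddSubgroup.closure_le]
        rintro _ ⟨⟨a, b⟩, rfl⟩
        refine ⟨DFinsupp.single (Nat.pair a b + 1) 1, ?_⟩
        rw [zmodSumHom_single, zmodHom_one]
        simp [s]
      exact this (hgen ▸ AddSubgroup.mem_top d)
    exact hd
  obtain ⟨σ, hσ⟩ := AddMonoidHom.exists_extension_of_divisible hD _ hj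
    (zmodSumHom (fun i => p ^ o i) s hs)
  obtain ⟨δ, hδ⟩ := AddMonoidHom.exists_extension_of_divisible hD _ hj
    (zmodSumHom (fun i => p ^ o i) (fun i => w i (o i)) hδz)
  have hsingle : ∀ a : ℤ, zmodSumHom (fun i => p ^ o i) z hz (DFinsupp.single 0 (a : ZMod (p ^ o 0)))
      = a • c := fun a => by
    rw [zmodSumHom_single, zmodHom_intCast, hz0]
  obtain ⟨h1, h2⟩ := surjective_prod_mk_and_injective_prod_mk
    (zmodSumHom (fun i => p ^ o i) z hz) χ σ δ
    (fun a => by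
      obtain ⟨k, rfl⟩ := ZMod.intCast_surjective a
      refine ⟨DFinsupp.single 0 (k : ZMod (p ^ o 0)), ?_, ?_⟩
      · rw [hsingle, map_zsmul, hχ, zsmul_eq_mul, mul_one]
      · rw [hσ, zmodSumHom_single, zmodHom_intCast]
        exact smul_zero _)
    (fun d => (hσX d).imp fun x hx => by rw [hσ, hx])
    (fun x hx => by
      rw [hδ] at hx
      rw [hδX (hx.trans (map_zero _).symm), map_zero])
  refine ⟨_, _, χ, _, _, h1, h2, hχ, ?_⟩
  -- `c` vanishes modulo the sum, and its other coordinate `δ c` is divisible by `p` since `D` is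
  -- divisible.
  obtain ⟨b, hb⟩ := hD p (by exact_mod_cast hp.ne_zero) (δ c)
  refine ⟨(b, 0), ?_⟩
  have hc0 : QuotientAddGroup.mk' (zmodSumHom (fun i => p ^ o i) z hz).range c = 0 :=
    (QuotientAddGroup.eq_zero_iff _).mpr ⟨DFinsupp.single 0 ((1 : ℤ) : ZMod (p ^ o 0)), by
      rw [hsingle, one_smul]⟩
  rw [AddMonoidHom.prod_apply, hc0, ← hb, Prod.smul_mk, smul_zero, natCast_zsmul]

/-- The elements of order `p` that are divisible by `p ^ k`. -/
def socleAt (p k : ℕ) (G : Type*) [AddCommGroup G] : AddSubgroup G :=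
  (nsmulAddMonoidHom (α := G) p).ker ⊓ (nsmulAddMonoidHom (α := G) (p ^ k)).range

theorem socleAt_anti {p k l : ℕ} {G : Type*} [AddCommGroup G] (h : k ≤ l) :
    socleAt p l G ≤ socleAt p k G := by
  rintro x ⟨hx, g, rfl⟩
  obtain ⟨d, rfl⟩ := Nat.exists_eq_add_of_le h
  exact ⟨hx, p ^ d • g, by simp [pow_add, mul_smul]⟩

/-- The `p`-primary part of an abelian group. -/
def primaryPart (p : ℕ) (G : Type*) [AddCommGroup G] : AddSubgroup G where
  carrier := {x | ∃ e : ℕ, p ^ e • x = 0}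
  zero_mem' := ⟨0, by simp⟩
  add_mem' := by
    rintro x y ⟨e, he⟩ ⟨e', he'⟩
    exact ⟨e + e', by rw [smul_add, pow_add, mul_smul, mul_smul, he', smul_comm, he]; simp⟩
  neg_mem' := by
    rintro x ⟨e, he⟩
    exact ⟨e, by rw [smul_neg, he, neg_zero]⟩

theorem mem_primaryPart_of_pow_nsmul {p : ℕ} {G : Type*} [AddCommGroup G] {x : G} {i : ℕ}
    (h : p ^ i • x ∈ primaryPart p G) : x ∈ primaryPart p G := by
  obtain ⟨e, he⟩ := h
  exact ⟨e + i, by rw [pow_add, mul_smul, he]⟩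

theorem DFinsupp.exists_pow_nsmul_eq_of_socle {p : ℕ} (hp : p.Prime) (o : ℕ → ℕ) (ho : ∀ i, 1 ≤ o i)
    (x : Π₀ i, ZMod (p ^ o i)) (hx : p • x = 0) (l : ℕ) (hl : ∀ i, x i ≠ 0 → l ≤ o i - 1) :
    ∃ x', p ^ l • x' = x := by
  classical
  have hsoc : ∀ i, ∃ b : ZMod (p ^ o i), p ^ l • b = x i := fun i => by
    by_cases h0 : x i = 0
    · exact ⟨0, by rw [h0, smul_zero]⟩
    obtain ⟨k, hk⟩ := ZMod.exists_of_prime_nsmul_eq_zero hp (ho i) (x i) (by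
      have := DFunLike.congr_fun hx i
      simpa using this)
    refine ⟨((k * p ^ (o i - 1 - l) : ℤ) : ZMod (p ^ o i)), ?_⟩
    rw [hk, nsmul_eq_mul]
    push_cast
    rw [mul_left_comm, ← pow_add, Nat.add_sub_cancel' (hl i h0)]
  choose b hb using hsoc
  refine ⟨DFinsupp.mk x.support fun i => b i, DFinsupp.ext fun i => ?_⟩
  rw [DFinsupp.smul_apply, DFinsupp.mk_apply]
  split_ifs with h
  · exact hb i
  · rw [smul_zero, DFinsupp.notMem_support_iff.mp h]

/-- The analogue of `exists_embedding_of_infinite_socles` if the elements of order `p` of large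
height are finite in number. -/
theorem exists_embedding_of_finite_socle.{u} {G : Type u} [AddCommGroup G] {p m n : ℕ}
    (hp : p.Prime) (hm : 1 ≤ m) (hmn : m ≤ n) (c : G) (hc : p ^ m • c = 0)
    (hy : ∀ g, p ^ m • g ≠ p ^ (m - 1) • c) (hfin : (socleAt p n G : Set G).Finite)
    (hinf : (socleAt p (n - 1) G : Set G).Infinite) :
    ∃ (A : Type u) (_ : AddCommGroup A) (χ : G →+ ZMod (p ^ m)) (σ ψ : G →+ A),
      Function.Surjective (χ.prod σ) ∧ Function.Injective ψ ∧ χ c = 1 ∧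
        (m < n → ∃ a, p • a = ψ c) := by
  classical
  let o : ℕ → ℕ := fun i => Nat.casesOn i m (fun _ => n)
  have ho : ∀ i, 1 ≤ o i := fun i => by
    cases i with
    | zero => exact hm
    | succ i => exact hm.trans hmn
  have hon : ∀ i, o i ≤ n := fun i => by
    cases i with
    | zero => exact hmn
    | succ i => exact le_rfl
  have hpy : p • p ^ (m - 1) • c = 0 := by rw [← mul_smul, ← pow_succ', Nat.sub_add_cancel hm, hc]
  -- Taking `W = socleAt p n G` keeps the non-zero socle elements of the sum out of `p ^ n G`, as
  -- purity at exponents `≥ n` requires.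
  obtain ⟨z, hz, hz0, hsoc⟩ := exists_zmodSumHom_socle hp o ho c hc (socleAt p n G) hfin
    (by
      rintro ⟨-, g, hg⟩
      obtain ⟨d, rfl⟩ := Nat.exists_eq_add_of_le hmn
      exact hy (p ^ d • g) (by rw [← mul_smul, ← pow_add]; exact hg))
    (fun i => hinf)
  set j := zmodSumHom (fun i => p ^ o i) z hz with hjdef
  have hj : Function.Injective j :=
    injective_of_socle (exists_pow_nsmul_eq_zero_dfinsupp o) _ fun x hx hx0 =>
      hsoc x hx (by rw [hx0]; exact AddSubgroup.zero_mem _)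
  have hX : ∀ x : Π₀ i, ZMod (p ^ o i), p ^ n • x = 0 := fun x => DFinsupp.ext fun i => by
    obtain ⟨d, hd⟩ := Nat.exists_eq_add_of_le (hon i)
    rw [DFinsupp.smul_apply, hd, pow_add, mul_comm, mul_smul, nsmul_eq_mul (p ^ o i),
      ZMod.natCast_self, zero_mul, smul_zero]
    rfl
  have hsingle : ∀ a : ℤ, j (DFinsupp.single 0 (a : ZMod (p ^ o 0))) = a • c := fun a => by
    rw [hjdef, zmodSumHom_single, zmodHom_intCast, hz0]
  obtain ⟨r, hr⟩ := exists_retraction_of_socle hp j hj n hX (by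
    intro i x g hx hg
    rcases lt_or_ge i m with him | him
    · exact DFinsupp.exists_pow_nsmul_eq_of_socle hp o ho x hx i fun k _ => by
        cases k with
        | zero => exact Nat.le_sub_one_of_lt him
        | succ k => exact Nat.le_sub_one_of_lt (him.trans_le hmn)
    rcases lt_or_ge i n with hin | hin
    · refine DFinsupp.exists_pow_nsmul_eq_of_socle hp o ho x hx i fun k hk => ?_
      cases k with
      | succ k => exact Nat.le_sub_one_of_lt hin
      | zero =>
        -- If the coordinate at `c` is non-zero, subtracting the other coordinates, which are
        -- divisible by `p ^ i`, would make `p ^ (m - 1) • c` divisible by `p ^ m`.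
        exfalso
        obtain ⟨x', hx'⟩ := DFinsupp.exists_pow_nsmul_eq_of_socle hp o ho (x.erase 0)
          (DFinsupp.ext fun k => by
            have := DFunLike.congr_fun hx k
            rw [DFinsupp.smul_apply, DFinsupp.erase_apply]
            split_ifs
            · exact smul_zero _
            · exact this) i (fun k hk => by
            cases k with
            | zero => exact absurd (DFinsupp.erase_same) hk
            | succ k => exact Nat.le_sub_one_of_lt hin)
        obtain ⟨k, hxk⟩ := ZMod.exists_of_prime_nsmul_eq_zero hp (ho 0) (x 0) (by
          have := DFunLike.congr_fun hx 0
          simpa using this)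
        have hkp : ¬ (p : ℤ) ∣ k := fun h => hk (by
          rw [hxk]; exact ZMod.intCast_mul_pow_eq_zero (ho 0) h)
        have e : j x = k • p ^ (m - 1) • c + p ^ i • j x' := by
          rw [← map_nsmul, hx']
          nth_rewrite 1 [← DFinsupp.single_add_erase 0 x]
          rw [map_add, hxk, hsingle, mul_smul, ← natCast_zsmul (n := p ^ (m - 1))]
          norm_cast
        obtain ⟨d, hd⟩ := Nat.exists_eq_add_of_le him
        obtain ⟨g', hg'⟩ := (nsmulAddMonoidHom (α := G) (p ^ m)).range.mem_of_coprime_zsmul_mem hp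
          (v := p ^ (m - 1) • c) (by rw [hpy]; exact AddSubgroup.zero_mem _) hkp
          ⟨p ^ d • (g - j x'), by
            change p ^ m • p ^ d • (g - j x') = _
            rw [← mul_smul, ← pow_add, ← hd, smul_sub, hg, e, add_sub_cancel_right]⟩
        exact hy g' hg'
    · refine ⟨0, ?_⟩
      rw [smul_zero]
      refine (hsoc x hx (socleAt_anti hin ⟨?_, g, hg⟩)).symm
      change p • j x = 0
      rw [← map_nsmul, hx, map_zero])
  let D := ℕ →₀ ZMod (p ^ n)
  have hDn : ∀ d : D, p ^ n • d = 0 := fun d => Finsupp.ext fun i => by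
    rw [Finsupp.smul_apply, nsmul_eq_mul, ZMod.natCast_self, zero_mul]; rfl
  let w : ℕ → D := fun i => Finsupp.single i 1
  -- The embedding sends `c` to `p ^ (n - m) • w 0`, a multiple of `p` if `m < n`; the surjection
  -- `s` kills `c` and shifts the other generators.
  let t : ℕ → D := fun i => Nat.casesOn i (p ^ (n - m) • w 0) (fun i => w (i + 1))
  have ht : ∀ i, p ^ o i • t i = 0 := fun i => by
    cases i with
    | zero =>
      change p ^ m • p ^ (n - m) • w 0 = 0
      rw [← mul_smul, ← pow_add, Nat.add_sub_cancel' hmn, hDn]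
    | succ i => exact hDn _
  have htw : ∀ i, p ^ (o i - 1) • t i = p ^ (n - 1) • w i := fun i => by
    cases i with
    | zero =>
      change p ^ (m - 1) • p ^ (n - m) • w 0 = _
      rw [← mul_smul, ← pow_add]
      congr 2
      omega
    | succ i => rfl
  let s : ℕ → D := fun i => Nat.casesOn i 0 w
  have hs : ∀ i, p ^ o i • s i = 0 := fun i => by
    cases i with
    | zero => exact smul_zero _
    | succ i => exact hDn _
  let F : ℕ → AddSubgroup D := fun i =>
    { carrier := {d | ∀ j, i ≤ j → d j = 0}
      zero_mem' := fun j _ => rfl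
      add_mem' := fun {a b} ha hb j hj => by rw [Finsupp.add_apply, ha j hj, hb j hj, add_zero]
      neg_mem' := fun {a} ha j hj => by rw [Finsupp.neg_apply, ha j hj, neg_zero] }
  have hδX : Function.Injective (zmodSumHom (fun i => p ^ o i) t ht) := by
    refine zmodSumHom_injective hp o ho _ ht F (fun i i' h d hd j hj => hd j (h.trans hj)) ?_ ?_
    · intro i l hl
      rw [htw, Finsupp.smul_apply, Finsupp.single_apply, if_neg (by omega), smul_zero]
    · intro i h
      have h1 := h i le_rfl
      rw [htw, Finsupp.smul_apply, Finsupp.single_eq_same, nsmul_eq_mul, mul_one,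
        ZMod.natCast_eq_zero_iff, Nat.pow_dvd_pow_iff_le_right hp.one_lt] at h1
      omega
  have hσX : ∀ d, ∃ x, zmodSumHom (fun i => p ^ o i) s hs x = d := by
    intro d
    induction d using Finsupp.induction with
    | zero => exact ⟨0, map_zero _⟩
    | single_add i b f _ _ ih =>
      obtain ⟨x, hx⟩ := ih
      obtain ⟨k, rfl⟩ := ZMod.intCast_surjective b
      refine ⟨DFinsupp.single (i + 1) ((k : ℤ) : ZMod (p ^ o (i + 1))) + x, ?_⟩
      rw [map_add, hx, zmodSumHom_single, zmodHom_intCast]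
      congr 1
      change k • Finsupp.single i 1 = _
      rw [Finsupp.smul_single, zsmul_eq_mul, mul_one]
  obtain ⟨h1, h2⟩ := surjective_prod_mk_and_injective_prod_mk j
    ((DFinsupp.evalAddMonoidHom 0 : (Π₀ i, ZMod (p ^ o i)) →+ ZMod (p ^ o 0)).comp r)
    ((zmodSumHom (fun i => p ^ o i) s hs).comp r) ((zmodSumHom (fun i => p ^ o i) t ht).comp r)
    (fun a => by
      refine ⟨DFinsupp.single 0 a, ?_, ?_⟩
      · rw [AddMonoidHom.comp_apply, hr]
        change (DFinsupp.single 0 a : Π₀ i, ZMod (p ^ o i)) 0 = a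
        simp
      · obtain ⟨k, rfl⟩ := ZMod.intCast_surjective a
        rw [AddMonoidHom.comp_apply, hr, zmodSumHom_single, zmodHom_intCast]
        exact smul_zero _)
    (fun d => (hσX d).imp fun x hx => by rw [AddMonoidHom.comp_apply, hr, hx])
    (fun x hx => by
      rw [AddMonoidHom.comp_apply, hr] at hx
      rw [hδX (hx.trans (map_zero _).symm), map_zero])
  have hc1 : j (DFinsupp.single 0 ((1 : ℤ) : ZMod (p ^ o 0))) = c := by rw [hsingle, one_smul]
  have hrc : r c = DFinsupp.single 0 ((1 : ℤ) : ZMod (p ^ o 0)) := by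
    nth_rewrite 1 [← hc1]
    exact hr _
  refine ⟨_, _, _, _, _, h1, h2, ?_, fun hlt => ⟨(p ^ (n - m - 1) • w 0, 0), ?_⟩⟩
  · rw [AddMonoidHom.comp_apply, hrc]
    change (DFinsupp.single 0 ((1 : ℤ) : ZMod (p ^ o 0)) : Π₀ i, ZMod (p ^ o i)) 0 = 1
    simp
  · have hc0 : QuotientAddGroup.mk' j.range c = 0 :=
      (QuotientAddGroup.eq_zero_iff _).mpr ⟨_, hc1⟩
    rw [AddMonoidHom.prod_apply, hc0, AddMonoidHom.comp_apply, hrc, zmodSumHom_single,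
      zmodHom_intCast, Prod.smul_mk, smul_zero, one_smul, ← mul_smul, ← pow_succ',
      Nat.sub_add_cancel (by omega)]
    rfl

/-! ### Necessity of the prime condition -/

/-- If `p ^ (e + 1)` kills `y`, then `p ^ e • y = p ^ (e + 1) • z` for some `z` in `Y`, and `p ^ e`
kills `y - p • z`. -/
theorem divisible_of_socle {G : Type*} [AddCommGroup G] {p : ℕ} (Y : AddSubgroup G)
    (hY : ∀ y ∈ Y, ∃ e : ℕ, p ^ e • y = 0)
    (hsoc : ∀ (i : ℕ), ∀ y ∈ Y, p • y = 0 → ∃ y' ∈ Y, p ^ i • y' = y) :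
    ∀ y ∈ Y, ∃ y' ∈ Y, p • y' = y := by
  intro y hy
  obtain ⟨e, he⟩ := hY y hy
  induction e generalizing y with
  | zero => exact ⟨0, Y.zero_mem, by simpa using he.symm⟩
  | succ e ih =>
    obtain ⟨z, hz, hzy⟩ := hsoc (e + 1) (p ^ e • y) (Y.nsmul_mem hy _)
      (by rw [← mul_smul, ← pow_succ', he])
    obtain ⟨y', hy', h⟩ := ih (y - p • z) (Y.sub_mem hy (Y.nsmul_mem hz _)) (by
      rw [smul_sub, ← hzy, ← mul_smul, ← pow_succ, sub_self])
    exact ⟨y' + z, Y.add_mem hy' hz, by rw [smul_add, h, sub_add_cancel]⟩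

theorem exists_stable_socleAt {G : Type*} [AddCommGroup G] {p k : ℕ}
    (h : (socleAt p k G : Set G).Finite) :
    ∃ N, k ≤ N ∧ ∀ i, N ≤ i → socleAt p i G = socleAt p N G := by
  classical
  have hex : ∃ a, ∃ N, k ≤ N ∧ (socleAt p N G : Set G).ncard = a := ⟨_, k, le_rfl, rfl⟩
  obtain ⟨N, hkN, hN⟩ := Nat.find_spec hex
  refine ⟨N, hkN, fun i hi => SetLike.coe_injective ?_⟩
  refine Set.eq_of_subset_of_ncard_le (socleAt_anti hi) ?_ (h.subset (socleAt_anti hkN))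
  rw [hN]
  exact Nat.find_min' hex ⟨i, hkN.trans hi, rfl⟩

/-- Either the second alternative holds for all `k`, and `N = 1` works, or some `socleAt p k G` is
finite and the decreasing socles stabilize at some `N`. In both cases elements of order `p` and
height at least `N` have infinite height, so `p ^ N` times the `p`-torsion is divisible. -/
theorem exists_divisible_multiple {G : Type*} [AddCommGroup G] {p : ℕ}
    (h : ∀ k, 1 ≤ k → {x : G | p • x = 0 ∧ ∃ g, p ^ k • g = x}.Finite ∨
      ∀ g : G, p • p • g = 0 → ∃ g', p ^ k • g' = p • g) :
    ∃ N, ∀ t ∈ primaryPart p G, ∃ t', p ^ (N + 1) • t' = p ^ N • t := by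
  obtain ⟨N, hN⟩ : ∃ N, ∀ i y, y ∈ socleAt p N G → ∃ g, p ^ (N + i) • g = y := by
    by_cases hall : ∀ k, 1 ≤ k → ∀ g : G, p • p • g = 0 → ∃ g', p ^ k • g' = p • g
    · refine ⟨1, ?_⟩
      rintro i y ⟨hy, g, rfl⟩
      have e : (nsmulAddMonoidHom (α := G) (p ^ 1)) g = p • g := by simp
      rw [e] at hy ⊢
      exact hall (1 + i) (Nat.le_add_right 1 i) g hy
    · push Not at hall
      obtain ⟨k, hk, g, hg, hg'⟩ := hall
      have hfin : (socleAt p k G : Set G).Finite := (h k hk).resolve_right fun h' =>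
        (h' g hg).elim fun a ha => hg' a ha
      obtain ⟨N, -, hN⟩ := exists_stable_socleAt hfin
      refine ⟨N, fun i y hy => ?_⟩
      rw [← hN (N + i) (Nat.le_add_right N i)] at hy
      exact hy.2
  refine ⟨N, fun t ht => ?_⟩
  obtain ⟨_, ⟨-, g, rfl⟩, hg⟩ := divisible_of_socle
    (primaryPart p G ⊓ (nsmulAddMonoidHom (α := G) (p ^ N)).range)
    (fun y hy => hy.1) (by
      rintro i y ⟨hy, hyr⟩ hpy
      obtain ⟨g, hg⟩ := hN i y ⟨hpy, hyr⟩
      have e : p ^ i • p ^ N • g = y := by rw [← mul_smul, ← pow_add, add_comm, hg]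
      refine ⟨p ^ N • g, ⟨?_, g, rfl⟩, e⟩
      exact mem_primaryPart_of_pow_nsmul (i := i) (by rw [e]; exact hy))
    (p ^ N • t) ⟨AddSubgroup.nsmul_mem _ ht _, t, rfl⟩
  exact ⟨g, by rw [pow_succ', mul_smul]; exact hg⟩

theorem exists_isCompl_primaryPart {G : Type*} [AddCommGroup G] {p : ℕ} (hp : p.Prime) {N : ℕ}
    (hN : ∀ t ∈ primaryPart p G, ∃ t', p ^ (N + 1) • t' = p ^ N • t) :
    ∃ C, IsCompl (primaryPart p G) C :=
  AddSubgroup.exists_isCompl_of_pure_of_divisible hp _ (fun _ hx => hx) N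
    (fun t ht => (hN t ht).imp fun t' h => ⟨mem_primaryPart_of_pow_nsmul (i := N + 1)
      (by rw [h]; exact AddSubgroup.nsmul_mem _ ht _), h⟩)
    (fun _ m hm => ⟨m, mem_primaryPart_of_pow_nsmul hm, rfl⟩)

theorem exists_height {G : Type*} [AddCommGroup G] {p k : ℕ} {y : G} (hy : ∀ g, p ^ k • g ≠ y) :
    ∃ m, 1 ≤ m ∧ m ≤ k ∧ (∃ c, p ^ (m - 1) • c = y) ∧ ∀ g, p ^ m • g ≠ y := by
  classical
  have hex : ∃ m, ∀ g, p ^ m • g ≠ y := ⟨k, hy⟩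
  have h0 : Nat.find hex ≠ 0 := fun h => by
    have := Nat.find_spec hex
    rw [h] at this
    exact this y (by simp)
  refine ⟨Nat.find hex, Nat.pos_of_ne_zero h0, Nat.find_min' hex hy, ?_, Nat.find_spec hex⟩
  have := Nat.find_min hex (m := Nat.find hex - 1) (by omega)
  push Not at this
  exact this

theorem exists_infinite_finite_socleAt {G : Type*} [AddCommGroup G] {p k : ℕ}
    (hk : (socleAt p k G : Set G).Infinite) :
    (∀ l, (socleAt p l G : Set G).Infinite) ∨ ∃ n, k < n ∧ (socleAt p n G : Set G).Finite ∧
      (socleAt p (n - 1) G : Set G).Infinite := by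
  classical
  by_cases hall : ∀ l, (socleAt p l G : Set G).Infinite
  · exact Or.inl hall
  · right
    push Not at hall
    have hlt : ∀ n, (socleAt p n G : Set G).Finite → k < n := fun n hn => by
      by_contra! h
      exact hk (hn.subset (socleAt_anti h))
    have h1 := hlt _ (Nat.find_spec hall)
    exact ⟨Nat.find hall, h1, Nat.find_spec hall, Nat.find_min hall (by omega)⟩

theorem IsSemiGenCoBassian.primeCondition {G : Type*} [AddCommGroup G] (h : IsSemiGenCoBassian G)
    {p : ℕ} (hp : p.Prime) : PrimeCondition p G := by
  have hA : ∀ k, 1 ≤ k → {x : G | p • x = 0 ∧ ∃ g, p ^ k • g = x}.Finite ∨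
      ∀ g : G, p • p • g = 0 → ∃ g', p ^ k • g' = p • g := by
    by_contra! hcon
    obtain ⟨k, hk, hinf, g, hg, hgk⟩ := hcon
    obtain ⟨m, hm, hmk, ⟨c, hc⟩, hcm⟩ := exists_height hgk
    -- The element `p • g` has height at least one.
    have hm2 : 2 ≤ m := by
      by_contra! hlt
      obtain rfl : m = 1 := by omega
      exact hcm g (by simp)
    have hpc : p ^ m • c = 0 := by
      rw [← Nat.sub_add_cancel hm, pow_succ', mul_smul, hc, hg]
    rw [← hc] at hcm
    rcases exists_infinite_finite_socleAt (G := G) (p := p) (k := k) hinf with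
      hall | ⟨n, hkn, hfin, hinf'⟩
    · obtain ⟨A, _, χ, σ, ψ, h1, h2, h3, h4⟩ :=
        exists_embedding_of_infinite_socles hp hm c hpc hcm hall
      exact not_isSemiGenCoBassian_of_embedding hp hm2 χ σ ψ h1 h2 c h3 h4 h
    · obtain ⟨A, _, χ, σ, ψ, h1, h2, h3, h4⟩ :=
        exists_embedding_of_finite_socle hp hm (hmk.trans hkn.le) c hpc hcm hfin hinf'
      exact not_isSemiGenCoBassian_of_embedding hp hm2 χ σ ψ h1 h2 c h3
        (h4 (hmk.trans_lt hkn)) h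
  refine ⟨hA, ?_⟩
  by_contra! hcon
  obtain ⟨hinf, ⟨t, ht, htp⟩, g₀, hg₀⟩ := hcon
  have hinf0 : (socleAt p 0 G : Set G).Infinite := by
    refine hinf.mono fun x hx => ⟨hx, x, by simp⟩
  obtain ⟨N, hN⟩ := exists_divisible_multiple hA
  obtain ⟨C, hC⟩ := exists_isCompl_primaryPart hp hN
  obtain ⟨τ, hτC, hτT, hτ, hτ'⟩ := AddSubgroup.exists_projection_of_isCompl hC.symm
  -- With `τ` the projection onto the `p`-torsion, `τ + p ^ m (1 - τ)` meets the demands on `ε`: it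
  -- is injective because the complement has no `p`-torsion.
  have key : ∀ (m : ℕ) (A : Type _) (_ : AddCommGroup A) (χ : G →+ ZMod (p ^ m)) (σ ψ : G →+ A),
      1 ≤ m → Function.Surjective (χ.prod σ) → Function.Injective ψ → False := by
    intro m A _ χ σ ψ hm hσ hψ
    have hε : ∀ g, (τ + p ^ m • (AddMonoidHom.id G - τ)) g = τ g + p ^ m • (g - τ g) :=
      fun g => rfl
    refine not_isSemiGenCoBassian_of_endomorphism hp hm χ σ ψ hσ hψ
      (τ + p ^ m • (AddMonoidHom.id G - τ)) ?_ ?_ ?_ g₀ ?_ h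
    · rw [injective_iff_map_eq_zero]
      intro g hg
      rw [hε] at hg
      have e1 : p ^ m • (g - τ g) = 0 := by
        refine AddSubgroup.isCompl_mem_eq_zero hC ?_ (C.nsmul_mem (hτ' g) _)
        rw [← neg_eq_of_add_eq_zero_right hg]
        exact AddSubgroup.neg_mem _ (hτ g)
      have e2 : g - τ g = 0 := AddSubgroup.isCompl_mem_eq_zero hC ⟨m, e1⟩ (hτ' g)
      rw [e1, add_zero] at hg
      rwa [hg, sub_zero] at e2
    · intro t ht
      rw [hε, hτT t ht, sub_self, smul_zero, add_zero]
    · intro g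
      exact ⟨τ g, g - τ g, hτ g, hε g⟩
    · exact hg₀
  rcases exists_infinite_finite_socleAt hinf0 with hall | ⟨n, hkn, hfin, hinf'⟩
  · obtain ⟨y, hpy, i, hyi⟩ : ∃ y : G, p • y = 0 ∧ ∃ i, ∀ g, p ^ i • g ≠ y := by
      by_contra! hno
      obtain ⟨t', -, ht'⟩ := divisible_of_socle (primaryPart p G) (fun y hy => hy) (fun i y hy hpy => by
        obtain ⟨g, hg⟩ := hno y hpy i
        exact ⟨g, mem_primaryPart_of_pow_nsmul (i := i) (by rw [hg]; exact hy), hg⟩) t ht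
      exact htp t' ht'
    obtain ⟨m, hm, -, ⟨c, hc⟩, hcm⟩ := exists_height hyi
    have hpc : p ^ m • c = 0 := by
      rw [← Nat.sub_add_cancel hm, pow_succ', mul_smul, hc, hpy]
    rw [← hc] at hcm
    obtain ⟨A, _, χ, σ, ψ, h1, h2, h3, h4⟩ :=
      exists_embedding_of_infinite_socles hp hm c hpc hcm hall
    exact key m A _ χ σ ψ hm h1 h2
  · obtain ⟨y, ⟨hpy, c, hc⟩, hy⟩ := hinf'.exists_notMem_finite hfin
    have hpy' : p • y = 0 := hpy
    have hc' : p ^ (n - 1) • c = y := hc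
    have hpc : p ^ n • c = 0 := by
      rw [← Nat.sub_add_cancel (show 1 ≤ n from hkn), pow_succ', mul_smul, hc', hpy']
    -- The exponent `m = n` is allowed, as this obstruction does not need the image of `c` to be
    -- divisible by `p`.
    obtain ⟨A, _, χ, σ, ψ, h1, h2, h3, h4⟩ :=
      exists_embedding_of_finite_socle hp hkn le_rfl c hpc
        (fun g hg => hy ⟨hpy, g, hg.trans hc'⟩) hfin hinf'
    exact key n A _ χ σ ψ hkn h1 h2

/-! ### Summands of a `p`-group around a given subgroup -/

theorem Int.eq_zero_or_exists_prime_pow_mul {p : ℕ} (hp : p.Prime) (a : ℤ) :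
    a = 0 ∨ ∃ (i : ℕ) (b : ℤ), a = b * (p : ℤ) ^ i ∧ ¬ (p : ℤ) ∣ b := by
  by_cases ha : a = 0
  · exact Or.inl ha
  · have hfin : FiniteMultiplicity (p : ℤ) a :=
      Int.finiteMultiplicity_iff.mpr ⟨by simpa using hp.ne_one, ha⟩
    obtain ⟨b, hb, hpb⟩ := hfin.exists_eq_pow_mul_and_not_dvd
    exact Or.inr ⟨_, b, by rw [hb, mul_comm], hpb⟩

theorem AddSubgroup.isCompl_comap_of_isCompl_map {A : Type*} [AddCommGroup A]
    {K C : AddSubgroup A} (hCK : ∀ c ∈ C, c ∈ K → c = 0) {R : AddSubgroup (A ⧸ K)}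
    (hR : IsCompl (C.map (QuotientAddGroup.mk' K)) R) :
    IsCompl (R.comap (QuotientAddGroup.mk' K)) C := by
  refine IsCompl.of_eq ?_ ?_
  · rw [eq_bot_iff]
    rintro x ⟨hx, hxC⟩
    have h0 : QuotientAddGroup.mk' K x = 0 := AddSubgroup.isCompl_mem_eq_zero hR ⟨x, hxC, rfl⟩ hx
    exact hCK x hxC ((QuotientAddGroup.eq_zero_iff x).mp h0)
  · rw [eq_top_iff]
    rintro x -
    obtain ⟨_, ⟨c, hc, rfl⟩, r, hr, hcr⟩ :=
      AddSubgroup.isCompl_exists_add hR (QuotientAddGroup.mk' K x)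
    refine AddSubgroup.mem_sup.mpr ⟨x - c, ?_, c, hc, sub_add_cancel _ _⟩
    change QuotientAddGroup.mk' K (x - c) ∈ R
    rw [map_sub, ← hcr, add_sub_cancel_left]
    exact hr

/-- `C` is maximal in `p ^ N U` with `C ⊓ K = ⊥`. Let `c = p • p ^ N • v` with `p ^ N • v ∉ C`.
Maximality gives a non-zero `c' + a • p ^ N • v` in `K`, with `a` prime to `p`; `p` times it lies in
`C ⊓ K`, so is zero. Thus `p ^ N • v` is an element of `C` up to an element killed by `p`, and that
element of `C` divides `c`. -/
theorem exists_maximal_divisible_disjoint {U : Type*} [AddCommGroup U] {p : ℕ} (hp : p.Prime)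
    {N : ℕ} (hN : ∀ u : U, ∃ v, p ^ (N + 1) • v = p ^ N • u) (K : AddSubgroup U) :
    ∃ C : AddSubgroup U, (∀ c ∈ C, c ∈ K → c = 0) ∧ (∀ c ∈ C, ∃ c' ∈ C, p • c' = c) ∧
      ∀ v : U, p ^ N • v ∈ C ∨ ∃ c ∈ C, ∃ a : ℤ, c + a • p ^ N • v ∈ K ∧ c + a • p ^ N • v ≠ 0 := by
  let s : Set (AddSubgroup U) :=
    {C | C ≤ (nsmulAddMonoidHom (α := U) (p ^ N)).range ∧ ∀ c ∈ C, c ∈ K → c = 0}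
  obtain ⟨C, hC⟩ : ∃ C, Maximal (· ∈ s) C := by
    apply zorn_le₀
    intro c hcs hc
    rcases c.eq_empty_or_nonempty with rfl | hne
    · exact ⟨⊥, ⟨bot_le, fun c hc _ => AddSubgroup.mem_bot.mp hc⟩, by simp⟩
    · refine ⟨sSup c, ⟨sSup_le fun b hb => (hcs hb).1, fun x hx hxK => ?_⟩, fun z hz => le_sSup hz⟩
      obtain ⟨B, hB, hxB⟩ := (AddSubgroup.mem_sSup_of_isChain hc hne).mp hx
      exact (hcs hB).2 x hxB hxK
  have hmax : ∀ v : U, p ^ N • v ∈ C ∨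
      ∃ c ∈ C, ∃ a : ℤ, c + a • p ^ N • v ∈ K ∧ c + a • p ^ N • v ≠ 0 := by
    intro v
    by_contra! hcon
    refine hcon.1 (hC.2 (y := C ⊔ AddSubgroup.zmultiples (p ^ N • v)) ⟨?_, ?_⟩ le_sup_left
      (le_sup_right (a := C) (AddSubgroup.mem_zmultiples _)))
    · refine sup_le hC.1.1 ?_
      rw [AddSubgroup.zmultiples_le]
      exact ⟨v, rfl⟩
    · intro x hx hxK
      obtain ⟨c, hc, y, hy, rfl⟩ := AddSubgroup.mem_sup.mp hx
      obtain ⟨a, rfl⟩ := AddSubgroup.mem_zmultiples_iff.mp hy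
      exact hcon.2 c hc a hxK
  refine ⟨C, hC.1.2, fun c hc => ?_, hmax⟩
  obtain ⟨u₀, hu₀⟩ := hC.1.1 hc
  obtain ⟨v, hv⟩ := hN u₀
  have hpv : p • p ^ N • v = c := by rw [← mul_smul, ← pow_succ', hv]; exact hu₀
  rcases hmax v with h | ⟨c', hc', a, hk, hk0⟩
  · exact ⟨_, h, hpv⟩
  have hpa : ¬ (p : ℤ) ∣ a := by
    rintro ⟨b, rfl⟩
    refine hk0 (hC.1.2 _ (C.add_mem hc' ?_) hk)
    rw [mul_comm, mul_smul, natCast_zsmul, hpv]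
    exact C.zsmul_mem hc b
  have hpk : p • (c' + a • p ^ N • v) = 0 := by
    refine hC.1.2 _ ?_ (K.nsmul_mem hk p)
    rw [smul_add, smul_comm p a, hpv]
    exact C.add_mem (C.nsmul_mem hc' _) (C.zsmul_mem hc a)
  obtain ⟨x, y, hxy⟩ := Int.isCoprime_prime_pow hp hpa 1
  rw [pow_one] at hxy
  refine ⟨y • c - x • c', C.sub_mem (C.zsmul_mem hc y) (C.zsmul_mem hc' x), ?_⟩
  have h1 : p ^ N • v = x • (c' + a • p ^ N • v) + (y • c - x • c') := by
    have : p ^ N • v = (x * a + y * p) • p ^ N • v := by rw [hxy, one_smul]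
    nth_rewrite 1 [this]
    rw [add_smul, mul_smul, mul_smul, natCast_zsmul, hpv, smul_add]
    abel
  have h2 : p • p ^ N • v = p • (y • c - x • c') := by
    conv_lhs => rw [h1, smul_add p (x • _) _, smul_comm p x, hpk, smul_zero, zero_add]
  rw [← h2, hpv]

/-- A subgroup `K` of a `p`-group with a divisible multiple such that heights of the elements of
`pK` can be computed in `K` is, up to elements of order `p`, the whole of a direct summand. -/
theorem exists_isCompl_of_heights {U : Type*} [AddCommGroup U] {p : ℕ} (hp : p.Prime)
    (htor : ∀ u : U, ∃ e : ℕ, p ^ e • u = 0) {N : ℕ}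
    (hN : ∀ u : U, ∃ v, p ^ (N + 1) • v = p ^ N • u) (K : AddSubgroup U)
    (hK : ∀ j, 1 ≤ j → ∀ k ∈ K, ∀ u, p ^ j • u = p • k → ∃ k' ∈ K, p ^ j • k' = p • k) :
    ∃ S C : AddSubgroup U, IsCompl S C ∧ K ≤ S ∧ ∀ u, p • u = 0 → u ∈ K ⊔ C := by
  obtain ⟨C₁, hC₁K, hC₁d, hC₁m⟩ := exists_maximal_divisible_disjoint hp hN K
  -- The second condition makes the image of `C` pure in `U ⧸ K`, with roots taken in `C` itself; it
  -- holds for `C₁` by divisibility. The image of a maximal `C` is then a summand, and `S` is the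
  -- preimage of a complement.
  let s : Set (AddSubgroup U) := {C | (∀ c ∈ C, c ∈ K → c = 0) ∧
    ∀ (l : ℕ), ∀ c ∈ C, ∀ (u : U), ∀ k ∈ K, c = p ^ l • u + k → ∃ c' ∈ C, p ^ l • c' = c}
  have hC₁s : C₁ ∈ s := by
    have hdiv : ∀ (l : ℕ), ∀ c ∈ C₁, ∃ c' ∈ C₁, p ^ l • c' = c := by
      intro l
      induction l with
      | zero => exact fun c hc => ⟨c, hc, by simp⟩
      | succ l ih =>
        intro c hc
        obtain ⟨c', hc', h⟩ := hC₁d c hc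
        obtain ⟨c'', hc'', h'⟩ := ih c' hc'
        exact ⟨c'', hc'', by rw [pow_succ', mul_smul, h', h]⟩
    exact ⟨hC₁K, fun l c hc _ _ _ _ => hdiv l c hc⟩
  obtain ⟨C, hC₁C, hC⟩ : ∃ C, C₁ ≤ C ∧ Maximal (· ∈ s) C := by
    refine zorn_le_nonempty₀ s (fun c hcs hc y hy => ?_) C₁ hC₁s
    refine ⟨sSup c, ⟨fun x hx hxK => ?_, fun l x hx u k hk h => ?_⟩, fun z hz => le_sSup hz⟩
    · obtain ⟨B, hB, hxB⟩ := (AddSubgroup.mem_sSup_of_isChain hc ⟨y, hy⟩).mp hx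
      exact (hcs hB).1 x hxB hxK
    · obtain ⟨B, hB, hxB⟩ := (AddSubgroup.mem_sSup_of_isChain hc ⟨y, hy⟩).mp hx
      obtain ⟨c', hc', e⟩ := (hcs hB).2 l x hxB u k hk h
      exact ⟨c', le_sSup hB hc', e⟩
  obtain ⟨hCK, hCp⟩ : C ∈ s := hC.1
  obtain ⟨R, hR⟩ := AddSubgroup.exists_isCompl_of_pure_of_divisible hp
    (C.map (QuotientAddGroup.mk' K))
    (by
      rintro _ ⟨c, hc, rfl⟩
      exact (htor c).imp fun e he => by rw [← map_nsmul, he, map_zero])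
    N
    (by
      rintro _ ⟨c, hc, rfl⟩
      obtain ⟨v, hv⟩ := hN c
      obtain ⟨c', hc', h⟩ := hCp (N + 1) (p ^ N • c) (C.nsmul_mem hc _) v 0 K.zero_mem
        (by rw [hv, add_zero])
      exact ⟨_, ⟨c', hc', rfl⟩, by rw [← map_nsmul, ← map_nsmul, h]⟩)
    (by
      intro i q hq
      obtain ⟨m, rfl⟩ := QuotientAddGroup.mk'_surjective K q
      obtain ⟨c, hc, hcm⟩ := hq
      rw [← map_nsmul] at hcm ⊢
      have hk : c - p ^ i • m ∈ K := by
        rw [← QuotientAddGroup.eq_zero_iff]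
        change QuotientAddGroup.mk' K _ = 0
        rw [map_sub, hcm, sub_self]
      obtain ⟨c', hc', h⟩ := hCp i c hc m _ hk (by abel)
      exact ⟨_, ⟨c', hc', rfl⟩, by rw [← map_nsmul, h, hcm]⟩)
  have hSC := AddSubgroup.isCompl_comap_of_isCompl_map hCK hR
  have hKS : K ≤ R.comap (QuotientAddGroup.mk' K) := fun k hk => by
    have : QuotientAddGroup.mk' K k = 0 := (QuotientAddGroup.eq_zero_iff k).mpr hk
    change QuotientAddGroup.mk' K k ∈ R
    rw [this]
    exact R.zero_mem
  generalize R.comap (QuotientAddGroup.mk' K) = S at hSC hKS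
  refine ⟨S, C, hSC, hKS, ?_⟩
  suffices hS : ∀ x ∈ S, p • x = 0 → x ∈ K by
    intro u hu
    obtain ⟨x, hx, c, hc, rfl⟩ := AddSubgroup.isCompl_exists_add hSC u
    refine AddSubgroup.add_mem_sup (hS x hx ?_) hc
    refine AddSubgroup.isCompl_mem_eq_zero hSC (S.nsmul_mem hx p) ?_
    rw [smul_add] at hu
    rw [eq_neg_of_add_eq_zero_left hu]
    exact C.neg_mem (C.nsmul_mem hc p)
  by_contra! hex
  -- By the choice of `C₁`, elements of order `p` in `S` that lie in `p ^ N U` belong to `K`, so `j`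
  -- is bounded. For maximal `j`, the `S`-component of the witness could be adjoined to `C`, which
  -- contradicts maximality.
  let P : ℕ → Prop := fun j => ∃ u, p ^ j • u ∈ S ∧ p • p ^ j • u = 0 ∧ p ^ j • u ∉ K
  have hP0 : P 0 := by
    obtain ⟨x, hx, hpx, hxK⟩ := hex
    exact ⟨x, by simpa using ⟨hx, hpx, hxK⟩⟩
  have hPN : ∀ j, P j → j ≤ N := by
    rintro j ⟨u, huS, hpu, huK⟩
    by_contra! hj
    obtain ⟨d, rfl⟩ := Nat.exists_eq_add_of_le hj.le
    rw [pow_add, mul_smul] at huS hpu huK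
    rcases hC₁m (p ^ d • u) with h | ⟨c, hc, a, hk, hk0⟩
    · exact huK (by
        rw [AddSubgroup.isCompl_mem_eq_zero hSC huS (hC₁C h)]
        exact K.zero_mem)
    · have hc0 : c = 0 := by
        refine AddSubgroup.isCompl_mem_eq_zero hSC ?_ (hC₁C hc)
        have := S.sub_mem (hKS hk) (S.zsmul_mem huS a)
        rwa [add_sub_cancel_right] at this
      rw [hc0, zero_add] at hk hk0
      refine huK (K.mem_of_coprime_zsmul_mem hp (by rw [hpu]; exact K.zero_mem) ?_ hk)
      rintro ⟨b, rfl⟩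
      rw [mul_comm, mul_smul, natCast_zsmul, hpu, smul_zero] at hk0
      exact hk0 rfl
  classical
  have hj := Nat.findGreatest_spec (P := P) (Nat.zero_le N) hP0
  have hjmax : ∀ i, P i → i ≤ Nat.findGreatest P N := fun i hi =>
    Nat.le_findGreatest (hPN i hi) hi
  generalize Nat.findGreatest P N = j at hj hjmax
  obtain ⟨u₀, hu₀S, hpu₀, hu₀K⟩ := hj
  obtain ⟨u, huS, c₀, hc₀, rfl⟩ := AddSubgroup.isCompl_exists_add hSC u₀
  have hc₀0 : p ^ j • c₀ = 0 := by
    refine AddSubgroup.isCompl_mem_eq_zero hSC ?_ (C.nsmul_mem hc₀ _)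
    have := S.sub_mem hu₀S (S.nsmul_mem huS (p ^ j))
    rwa [smul_add, add_sub_cancel_left] at this
  rw [smul_add, hc₀0, add_zero] at hpu₀ hu₀K
  have hcop : ∀ b : ℤ, ¬ (p : ℤ) ∣ b → b • p ^ j • u ∉ K := fun b hb h =>
    hu₀K (K.mem_of_coprime_zsmul_mem hp (by rw [hpu₀]; exact K.zero_mem) hb h)
  have hbig : ∀ (b : ℤ) (i : ℕ), j < i → (b * (p : ℤ) ^ i) • u = 0 := by
    intro b i hi
    obtain ⟨d, rfl⟩ := Nat.exists_eq_add_of_le (Nat.succ_le_of_lt hi)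
    have : ((p : ℤ) ^ (j.succ + d)) • u = p ^ d • p • p ^ j • u := by
      rw [← mul_smul, ← mul_smul, ← natCast_zsmul]
      congr 1
      push_cast
      rw [Nat.succ_eq_add_one]
      ring
    rw [mul_smul, this, hpu₀, smul_zero, smul_zero]
  have hu : u ∈ C := by
    refine hC.2 (y := C ⊔ AddSubgroup.zmultiples u) ⟨?_, ?_⟩ le_sup_left
      (le_sup_right (a := C) (AddSubgroup.mem_zmultiples u))
    · intro x hx hxK
      obtain ⟨c, hc, y, hy, rfl⟩ := AddSubgroup.mem_sup.mp hx
      obtain ⟨a, rfl⟩ := AddSubgroup.mem_zmultiples_iff.mp hy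
      have hc0 : c = 0 := by
        refine AddSubgroup.isCompl_mem_eq_zero hSC ?_ hc
        have := S.sub_mem (hKS hxK) (S.zsmul_mem huS a)
        rwa [add_sub_cancel_right] at this
      rw [hc0, zero_add] at hxK ⊢
      rcases Int.eq_zero_or_exists_prime_pow_mul hp a with rfl | ⟨i, b, rfl, hb⟩
      · exact zero_smul _ _
      rcases lt_or_ge j i with hi | hi
      · exact hbig b i hi
      · exfalso
        obtain ⟨d, rfl⟩ := Nat.exists_eq_add_of_le hi
        refine hcop b hb ?_
        have : b • p ^ (i + d) • u = p ^ d • (b * (p : ℤ) ^ i) • u := by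
          rw [← natCast_zsmul, ← natCast_zsmul, ← mul_smul, ← mul_smul]
          congr 1
          push_cast
          ring
        rw [this]
        exact K.nsmul_mem hxK _
    · intro l x hx v k hk hxv
      obtain ⟨c, hc, y, hy, rfl⟩ := AddSubgroup.mem_sup.mp hx
      obtain ⟨a, rfl⟩ := AddSubgroup.mem_zmultiples_iff.mp hy
      obtain ⟨vS, hvS, vC, hvC, rfl⟩ := AddSubgroup.isCompl_exists_add hSC v
      have e1 : c - p ^ l • vC = p ^ l • vS + k - a • u := by
        rw [smul_add] at hxv
        rw [sub_eq_sub_iff_add_eq_add, hxv]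
        abel
      have e2 : c - p ^ l • vC = 0 := by
        refine AddSubgroup.isCompl_mem_eq_zero hSC ?_ (C.sub_mem hc (C.nsmul_mem hvC _))
        rw [e1]
        exact S.sub_mem (S.add_mem (S.nsmul_mem hvS _) (hKS hk)) (S.zsmul_mem huS a)
      have e3 : a • u = p ^ l • vS + k := by
        rw [e2] at e1
        exact (sub_eq_zero.mp e1.symm).symm
      suffices h : ∃ b : ℤ, p ^ l • b • u = a • u by
        obtain ⟨b, hb⟩ := h
        exact ⟨vC + b • u, AddSubgroup.add_mem_sup hvC (AddSubgroup.mem_zmultiples_iff.mpr ⟨b, rfl⟩),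
          by rw [smul_add, hb, sub_eq_zero.mp e2]⟩
      rcases Int.eq_zero_or_exists_prime_pow_mul hp a with rfl | ⟨i, b, rfl, hb⟩
      · exact ⟨0, by simp⟩
      rcases lt_or_ge j i with hi | hi
      · exact ⟨0, by rw [hbig b i hi]; simp⟩
      rcases le_or_gt l i with hl | hl
      · refine ⟨b * (p : ℤ) ^ (i - l), ?_⟩
        rw [← natCast_zsmul, ← mul_smul]
        congr 1
        push_cast
        rw [mul_left_comm, ← pow_add, Nat.add_sub_cancel' hl]
      · exfalso
        obtain ⟨d, rfl⟩ := Nat.exists_eq_add_of_le hi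
        have e4 : b • p ^ (i + d) • u = p ^ (l + d) • vS + p ^ d • k := by
          have : b • p ^ (i + d) • u = p ^ d • (b * (p : ℤ) ^ i) • u := by
            rw [← natCast_zsmul, ← natCast_zsmul, ← mul_smul, ← mul_smul]
            congr 1
            push_cast
            ring
          rw [this, e3, smul_add, ← mul_smul, ← pow_add, add_comm d l]
        -- The height hypothesis replaces `p ^ d • k` by `p ^ (l + d) • k'` up to an element of `K`
        -- killed by `p`. Then `vS + k'` witnesses `P (l + d)`, although `l + d > j`.
        obtain ⟨k', hk', h⟩ := hK (l + d + 1) (Nat.le_add_left 1 _) (p ^ d • k) (K.nsmul_mem hk _)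
          (-vS) (by
            have h0 : p • b • p ^ (i + d) • u = 0 := by rw [smul_comm, hpu₀, smul_zero]
            rw [e4, smul_add] at h0
            rw [pow_succ', mul_smul, smul_neg, smul_neg]
            exact (eq_neg_of_add_eq_zero_right h0).symm)
        have e5 : p ^ (l + d) • (vS + k') =
            b • p ^ (i + d) • u - (p ^ d • k - p ^ (l + d) • k') := by
          rw [e4, smul_add]
          abel
        have hk3 : p ^ d • k - p ^ (l + d) • k' ∈ K :=
          K.sub_mem (K.nsmul_mem hk _) (K.nsmul_mem hk' _)
        have := hjmax (l + d) ⟨vS + k', ?_, ?_, ?_⟩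
        · omega
        · rw [e5]
          exact S.sub_mem (S.zsmul_mem (S.nsmul_mem huS _) b) (hKS hk3)
        · rw [e5, smul_sub, smul_comm p b, hpu₀, smul_sub, ← h, pow_succ', mul_smul, sub_self]
          simp
        · rw [e5]
          intro hmem
          have := K.add_mem hmem hk3
          rw [sub_add_cancel] at this
          exact hcop b hb this
  apply hu₀K
  rw [AddSubgroup.isCompl_mem_eq_zero hSC huS hu, smul_zero]
  exact K.zero_mem

/-! ### Assembling the primary components -/

theorem Nat.Prime.not_intCast_dvd_one {p : ℕ} (hp : p.Prime) : ¬ (p : ℤ) ∣ 1 := fun h =>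
  hp.ne_one (Nat.dvd_one.mp (by exact_mod_cast h))

/-- Some integer prime to `p` kills all components of `x` except that in `C p`, and it acts
invertibly on `p`-primary elements. -/
theorem mem_of_mem_iSup_of_mem_primaryPart {Q : Type*} [AddCommGroup Q]
    (C : {p : ℕ // p.Prime} → AddSubgroup Q) (hC : ∀ p, C p ≤ primaryPart p Q)
    (p : {p : ℕ // p.Prime}) {x : Q} (hx : x ∈ ⨆ q, C q) (hxp : x ∈ primaryPart p Q) :
    x ∈ C p := by
  have key : ∃ c ∈ C p, ∃ m : ℤ, ¬ ((p : ℕ) : ℤ) ∣ m ∧ m • (x - c) = 0 := by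
    clear hxp
    induction hx using AddSubgroup.iSup_induction' with
    | hp q x hx =>
      by_cases hqp : q = p
      · subst hqp
        exact ⟨x, hx, 1, q.2.not_intCast_dvd_one, by simp⟩
      · obtain ⟨e, he⟩ := hC q hx
        refine ⟨0, AddSubgroup.zero_mem _, ((q : ℕ) : ℤ) ^ e, fun h => hqp ?_, ?_⟩
        · have h1 : (p : ℕ) ∣ (q : ℕ) ^ e := by exact_mod_cast h
          exact Subtype.ext ((Nat.prime_dvd_prime_iff_eq p.2 q.2).mp (p.2.dvd_of_dvd_pow h1)).symm
        · rw [sub_zero, ← he, ← natCast_zsmul]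
          norm_cast
    | h1 => exact ⟨0, AddSubgroup.zero_mem _, 1, p.2.not_intCast_dvd_one, by simp⟩
    | hadd x y _ _ hx hy =>
      obtain ⟨c, hc, m, hm, h⟩ := hx
      obtain ⟨c', hc', m', hm', h'⟩ := hy
      refine ⟨c + c', AddSubgroup.add_mem _ hc hc', m * m', fun hd => ?_, ?_⟩
      · exact ((Nat.prime_iff_prime_int.mp p.2).dvd_or_dvd hd).elim hm hm'
      · have e : x + y - (c + c') = (x - c) + (y - c') := by abel
        rw [e, smul_add, mul_smul, mul_smul, h', smul_comm, h]
        simp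
  obtain ⟨c, hc, m, hm, h⟩ := key
  obtain ⟨e, he⟩ := AddSubgroup.sub_mem _ hxp (hC p hc)
  obtain ⟨k, hk⟩ := exists_zsmul_eq_of_coprime (Int.isCoprime_prime_pow p.2 hm e) he
  rw [smul_comm, h, smul_zero] at hk
  rw [sub_eq_zero.mp hk.symm]
  exact hc

theorem eq_zero_of_zsmul_eq_zero_of_prime {Q : Type*} [AddCommGroup Q] (X : AddSubgroup Q)
    (hX : ∀ p : ℕ, p.Prime → ∀ x ∈ X, p • x = 0 → x = 0) {x : Q} (hx : x ∈ X) {n : ℤ} (hn : n ≠ 0)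
    (hnx : n • x = 0) : x = 0 := by
  have key : ∀ m : ℕ, m ≠ 0 → m • x = 0 → x = 0 := by
    intro m
    induction m using Nat.strong_induction_on with
    | _ m ih =>
      intro hm hmx
      by_cases h1 : m = 1
      · simpa [h1] using hmx
      obtain ⟨p, hp, k, rfl⟩ := Nat.exists_prime_and_dvd h1
      have hk : k ≠ 0 := fun h => hm (by rw [h, mul_zero])
      rw [mul_smul] at hmx
      exact ih k (lt_mul_left (Nat.pos_of_ne_zero hk) hp.one_lt) hk
        (hX p hp _ (X.nsmul_mem hx k) hmx)
  refine key n.natAbs (by simpa using hn) ?_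
  rcases Int.natAbs_eq n with h' | h'
  · rw [h', natCast_zsmul] at hnx
    exact hnx
  · rw [h', neg_smul, natCast_zsmul, neg_eq_zero] at hnx
    exact hnx

theorem exists_zsmul_eq_zero_of_mem_iSup {Q : Type*} [AddCommGroup Q]
    (C : {p : ℕ // p.Prime} → AddSubgroup Q) (hC : ∀ p, C p ≤ primaryPart p Q) {x : Q}
    (hx : x ∈ ⨆ q, C q) : ∃ n : ℤ, n ≠ 0 ∧ n • x = 0 := by
  induction hx using AddSubgroup.iSup_induction' with
  | hp q x hx =>
    obtain ⟨e, he⟩ := hC q hx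
    exact ⟨((q : ℕ) ^ e : ℕ), by exact_mod_cast pow_ne_zero e q.2.ne_zero, by
      rw [natCast_zsmul, he]⟩
  | h1 => exact ⟨1, one_ne_zero, smul_zero _⟩
  | hadd x y _ _ hx hy =>
    obtain ⟨m, hm, h⟩ := hx
    obtain ⟨n, hn, h'⟩ := hy
    exact ⟨m * n, mul_ne_zero hm hn, by
      rw [smul_add, mul_smul, mul_smul, h', smul_comm, h, smul_zero, smul_zero, add_zero]⟩

theorem mem_primaryPart_of_nsmul_eq_zero {Q : Type*} [AddCommGroup Q] {p : ℕ} {x : Q}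
    (hx : p • x = 0) : x ∈ primaryPart p Q :=
  ⟨1, by rw [pow_one, hx]⟩

/-- Trivial intersection is tested on elements of prime order. Spanning is by induction on an
annihilator of the element, one prime power being split off by Bézout. -/
theorem isCompl_iSup_of_primaryPart {Q : Type*} [AddCommGroup Q]
    (hQ : ∀ q : Q, ∃ n : ℤ, n ≠ 0 ∧ n • q = 0)
    (C R : {p : ℕ // p.Prime} → AddSubgroup Q) (hC : ∀ p, C p ≤ primaryPart p Q)
    (hR : ∀ p, R p ≤ primaryPart p Q) (hCR : ∀ p, ∀ x ∈ C p, x ∈ R p → x = 0)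
    (hsup : ∀ p : {p : ℕ // p.Prime}, primaryPart p Q ≤ C p ⊔ R p) :
    IsCompl (⨆ p, C p) (⨆ p, R p) := by
  have hQ' : ∀ q : Q, ∃ n : ℕ, n ≠ 0 ∧ n • q = 0 := fun q => by
    obtain ⟨n, hn, h⟩ := hQ q
    refine ⟨n.natAbs, by simpa using hn, ?_⟩
    rcases Int.natAbs_eq n with h' | h'
    · rw [h', natCast_zsmul] at h
      exact h
    · rw [h', neg_smul, natCast_zsmul, neg_eq_zero] at h
      exact h
  have split : ∀ n : ℕ, n ≠ 0 → n ≠ 1 → ∃ p : {p : ℕ // p.Prime}, ∃ e m : ℕ, m < n ∧ m ≠ 0 ∧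
      n = p ^ e * m ∧ ∃ a b : ℤ, a * ((p : ℕ) : ℤ) ^ e + b * m = 1 := by
    intro n h0 h1
    obtain ⟨p, hp, hpn⟩ := Nat.exists_prime_and_dvd h1
    obtain ⟨e, m, hm, rfl⟩ := Nat.exists_eq_pow_mul_and_not_dvd h0 p hp.ne_one
    have hm0 : m ≠ 0 := fun h => hm (h ▸ dvd_zero p)
    refine ⟨⟨p, hp⟩, e, m, ?_, hm0, rfl, ?_⟩
    · rcases e with _ | e
      · exact absurd (by simpa using hpn) hm
      · exact lt_mul_left (Nat.pos_of_ne_zero hm0) (Nat.one_lt_pow (by omega) hp.one_lt)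
    · obtain ⟨a, b, hab⟩ := Int.isCoprime_prime_pow hp (n := m) (by exact_mod_cast hm) e
      exact ⟨b, a, by rw [add_comm]; exact hab⟩
  refine IsCompl.of_eq ?_ ?_
  · rw [eq_bot_iff]
    rintro x ⟨hxC, hxR⟩
    obtain ⟨n, hn, hnx⟩ := hQ x
    refine eq_zero_of_zsmul_eq_zero_of_prime ((⨆ p, C p) ⊓ ⨆ p, R p) ?_ ⟨hxC, hxR⟩ hn hnx
    rintro p hp y ⟨hyC, hyR⟩ hy
    exact hCR ⟨p, hp⟩ y
      (mem_of_mem_iSup_of_mem_primaryPart C hC ⟨p, hp⟩ hyC (mem_primaryPart_of_nsmul_eq_zero hy))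
      (mem_of_mem_iSup_of_mem_primaryPart R hR ⟨p, hp⟩ hyR (mem_primaryPart_of_nsmul_eq_zero hy))
  · rw [eq_top_iff]
    rintro x -
    obtain ⟨n, hn, hnx⟩ := hQ' x
    induction n using Nat.strong_induction_on generalizing x with
    | _ n ih =>
      by_cases h1 : n = 1
      · have : x = 0 := by simpa [h1] using hnx
        rw [this]
        exact AddSubgroup.zero_mem _
      obtain ⟨p, e, m, hmn, hm, rfl, a, b, hab⟩ := split n hn h1
      have hx : x = a • ((p : ℕ) ^ e) • x + b • m • x := by
        rw [← natCast_zsmul, ← natCast_zsmul, ← mul_smul, ← mul_smul, ← add_smul]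
        push_cast
        rw [hab, one_smul]
      rw [hx]
      refine AddSubgroup.add_mem _ (AddSubgroup.zsmul_mem _ (ih m hmn hm ?_) a)
        (AddSubgroup.zsmul_mem _ ?_ b)
      · rw [← mul_smul, mul_comm, hnx]
      · exact sup_le_sup (le_iSup C p) (le_iSup R p) (hsup p ⟨e, by rw [← mul_smul, hnx]⟩)

/-! ### Counting elements of order `p` -/

theorem finite_torsion_of_finite_socle {G : Type*} [AddCommGroup G] {p : ℕ} (Y : AddSubgroup G)
    (hY : {y | y ∈ Y ∧ p • y = 0}.Finite) (e : ℕ) : {y | y ∈ Y ∧ p ^ e • y = 0}.Finite := by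
  induction e with
  | zero => exact (Set.finite_singleton 0).subset fun y hy => by simpa using hy.2
  | succ e ih =>
    refine (Set.Finite.preimage' (f := fun y : Y => p • (y : G)) ih fun b _ => ?_).image
      (Subtype.val) |>.subset fun y hy => ⟨⟨y, hy.1⟩, ⟨Y.nsmul_mem hy.1 p, ?_⟩, rfl⟩
    · rcases ((fun y : Y => p • (y : G)) ⁻¹' {b}).eq_empty_or_nonempty with h | ⟨y₀, hy₀⟩
      · rw [h]; exact Set.finite_empty
      · refine Set.Finite.of_finite_image (f := fun y : Y => (y : G) - y₀) (hY.subset ?_) ?_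
        · rintro _ ⟨y, hy, rfl⟩
          refine ⟨Y.sub_mem y.2 y₀.2, ?_⟩
          have h1 : p • (y : G) = b := hy
          have h2 : p • (y₀ : G) = b := hy₀
          change p • ((y : G) - y₀) = 0
          rw [smul_sub, h1, h2, sub_self]
        · intro y _ y' _ h
          exact Subtype.ext (sub_left_injective h)
    · rw [← mul_smul, ← pow_succ]
      exact hy.2

/-- The number of elements of order `p` does not grow in quotients of `p`-groups. -/
theorem ncard_socle_image_le {G A : Type*} [AddCommGroup G] [AddCommGroup A] {p : ℕ}
    (σ : G →+ A) (Y : AddSubgroup G) (hY : Y ≤ primaryPart p G)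
    (hfin : {y | y ∈ Y ∧ p • y = 0}.Finite) (Z : Set A)
    (hZ : ∀ z ∈ Z, p • z = 0 ∧ ∃ y ∈ Y, σ y = z) :
    Z.Finite ∧ Z.ncard ≤ {y | y ∈ Y ∧ p • y = 0}.ncard := by
  classical
  have key : ∀ s : Finset A, (s : Set A) ⊆ Z → s.card ≤ {y | y ∈ Y ∧ p • y = 0}.ncard := by
    intro s hs
    choose! t htY ht using fun z (hz : z ∈ Z) => (hZ z hz).2
    obtain ⟨e, he⟩ : ∃ e : ℕ, ∀ z ∈ s, p ^ e • p • t z = 0 := by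
      choose! e he using fun z (hz : z ∈ Z) => hY (Y.nsmul_mem (htY z hz) p)
      refine ⟨s.sup e, fun z hz => ?_⟩
      obtain ⟨d, hd⟩ := Nat.exists_eq_add_of_le (Finset.le_sup (f := e) hz)
      rw [hd, pow_add, mul_comm, mul_smul, he z (hs hz), smul_zero]
    -- Let `H` be this part of the kernel, finite thanks to the bound `e`, and `L = {y ∈ Y | p • y ∈
    -- H}`. Lifts of `s` plus elements of `H` inject `s × H` into `L`, and multiplication by `p`
    -- maps `L` to `H` with fibres no larger than the socle of `Y`. Cancelling `|H|` bounds `|s|`.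
    have hH : {y | (y ∈ Y ∧ p ^ e • y = 0) ∧ σ y = 0}.Finite :=
      (finite_torsion_of_finite_socle Y hfin e).subset fun y hy => hy.1
    have hL : {y | y ∈ Y ∧ p • y ∈ {y | (y ∈ Y ∧ p ^ e • y = 0) ∧ σ y = 0}}.Finite :=
      (finite_torsion_of_finite_socle Y hfin (e + 1)).subset fun y hy => ⟨hy.1, by
        rw [pow_succ, mul_smul]; exact hy.2.1.2⟩
    have h1 : (s ×ˢ hH.toFinset).card ≤ hL.toFinset.card := by
      refine Finset.card_le_card_of_injOn (fun x => t x.1 + x.2) ?_ ?_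
      · rintro ⟨z, y⟩ hzy
        simp only [Finset.coe_product, Set.mem_prod, Finset.mem_coe, Set.Finite.mem_toFinset,
          Set.mem_ofPred_eq] at hzy
        obtain ⟨hz, ⟨hyY, hye⟩, hy0⟩ := hzy
        have hzZ := hs hz
        rw [Finset.mem_coe, Set.Finite.mem_toFinset]
        refine ⟨Y.add_mem (htY z hzZ) hyY,
          ⟨Y.nsmul_mem (Y.add_mem (htY z hzZ) hyY) p, ?_⟩, ?_⟩
        · rw [smul_add, smul_add, he z hz, smul_comm, hye, smul_zero, add_zero]
        · rw [map_nsmul, map_add, ht z hzZ, hy0, add_zero, (hZ z hzZ).1]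
      · rintro ⟨z, y⟩ hzy ⟨z', y'⟩ hzy' h
        simp only [Finset.coe_product, Set.mem_prod, Finset.mem_coe, Set.Finite.mem_toFinset,
          Set.mem_ofPred_eq] at hzy hzy' h
        have e1 : z = z' := by
          have := congrArg σ h
          rwa [map_add, map_add, ht z (hs hzy.1), ht z' (hs hzy'.1), hzy.2.2, hzy'.2.2, add_zero,
            add_zero] at this
        subst e1
        exact Prod.ext rfl (add_left_cancel h)
    have h2 : hL.toFinset.card ≤ {y | y ∈ Y ∧ p • y = 0}.ncard * hH.toFinset.card := by
      refine (Finset.card_le_mul_card_image (f := fun y => p • y) _ _ fun b hb => ?_).trans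
        (Nat.mul_le_mul_left _ (Finset.card_le_card ?_))
      · obtain ⟨y₀, hy₀, hb⟩ := Finset.mem_image.mp hb
        rw [Set.Finite.mem_toFinset] at hy₀
        rw [Set.ncard_eq_toFinset_card _ hfin]
        refine Finset.card_le_card_of_injOn (fun y => y - y₀) ?_ fun y _ y' _ h =>
          sub_left_injective h
        intro y hy
        rw [Finset.mem_coe, Finset.mem_filter, Set.Finite.mem_toFinset] at hy
        rw [Finset.mem_coe, Set.Finite.mem_toFinset]
        refine ⟨Y.sub_mem hy.1.1 hy₀.1, ?_⟩
        rw [smul_sub, hy.2, ← hb, sub_self]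
      · intro b hb
        obtain ⟨y, hy, rfl⟩ := Finset.mem_image.mp hb
        rw [Set.Finite.mem_toFinset] at hy ⊢
        exact hy.2
    rw [Finset.card_product] at h1
    refine Nat.le_of_mul_le_mul_right (h1.trans h2) (Finset.card_pos.mpr ⟨0, ?_⟩)
    rw [Set.Finite.mem_toFinset]
    exact ⟨⟨Y.zero_mem, smul_zero _⟩, map_zero _⟩
  have hZfin : Z.Finite := by
    by_contra hinf
    obtain ⟨s, hs, hcard⟩ := Set.Infinite.exists_subset_card_eq hinf
      ({y | y ∈ Y ∧ p • y = 0}.ncard + 1)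
    have := key s hs
    omega
  refine ⟨hZfin, ?_⟩
  rw [Set.ncard_eq_toFinset_card _ hZfin]
  exact key _ (by simp)

/-! ### Embeddings into quotients by torsion subgroups, at one prime -/

section Quotient

variable {G A : Type*} [AddCommGroup G] [AddCommGroup A] {p : ℕ}

theorem exists_mem_primaryPart_of_surjective (hp : p.Prime) (σ : G →+ A)
    (hσ : Function.Surjective σ) (hker : ∀ g, σ g = 0 → ∃ n : ℤ, n ≠ 0 ∧ n • g = 0)
    {a : A} (ha : a ∈ primaryPart p A) : ∃ t ∈ primaryPart p G, σ t = a := by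
  obtain ⟨g, rfl⟩ := hσ a
  obtain ⟨e, he⟩ := ha
  obtain ⟨n, hn, hng⟩ := hker (p ^ e • g) (by rw [map_nsmul, he])
  rcases Int.eq_zero_or_exists_prime_pow_mul hp n with rfl | ⟨i, b, rfl, hb⟩
  · exact absurd rfl hn
  obtain ⟨x, y, hxy⟩ := Int.isCoprime_prime_pow hp hb e
  refine ⟨x • b • g, ⟨e + i, ?_⟩, ?_⟩
  · have : p ^ (e + i) • x • b • g = x • (b * (p : ℤ) ^ i) • p ^ e • g := by
      rw [← natCast_zsmul, ← natCast_zsmul, ← mul_smul, ← mul_smul, ← mul_smul, ← mul_smul]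
      congr 1
      push_cast
      ring
    rw [this, hng, smul_zero]
  · have : σ g = (x * b + y * (p : ℤ) ^ e) • σ g := by rw [hxy, one_smul]
    have h0 : ((p : ℤ) ^ e) • σ g = 0 := by
      rw [← he, ← natCast_zsmul]
      norm_cast
    rw [add_smul, mul_smul, mul_smul, h0, smul_zero, add_zero] at this
    rw [map_zsmul, map_zsmul, ← this]

/-- `φ` embeds the finite socle of `G` in that of `A`, which is no larger by `ncard_socle_image_le`
applied to `σ`; so `φ` is a bijection between them. -/
theorem exists_socleAt_of_finite (hp : p.Prime) (σ φ : G →+ A) (hσ : Function.Surjective σ)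
    (hker : ∀ g, σ g = 0 → ∃ n : ℤ, n ≠ 0 ∧ n • g = 0) (hφ : Function.Injective φ) {k : ℕ}
    (hfin : (socleAt p k G : Set G).Finite) {z : A} (hz : z ∈ socleAt p k A) :
    ∃ g ∈ socleAt p k G, φ g = z := by
  have hset : {y | y ∈ primaryPart p G ⊓ (nsmulAddMonoidHom (α := G) (p ^ k)).range ∧ p • y = 0} =
      socleAt p k G := by
    ext y
    constructor
    · rintro ⟨⟨-, hy⟩, hpy⟩
      exact ⟨hpy, hy⟩
    · rintro ⟨hpy, hy⟩
      exact ⟨⟨⟨1, by rw [pow_one]; exact hpy⟩, hy⟩, hpy⟩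
  obtain ⟨h1, h2⟩ := ncard_socle_image_le (p := p) σ
    (primaryPart p G ⊓ (nsmulAddMonoidHom (α := G) (p ^ k)).range) inf_le_left
    (by rw [hset]; exact hfin) (socleAt p k A) (by
      rintro z ⟨hpz, a, rfl⟩
      have ha : a ∈ primaryPart p A := mem_primaryPart_of_pow_nsmul (i := k) ⟨1, by
        rw [pow_one]; exact hpz⟩
      obtain ⟨t, ht, rfl⟩ := exists_mem_primaryPart_of_surjective hp σ hσ hker ha
      exact ⟨hpz, p ^ k • t, ⟨AddSubgroup.nsmul_mem _ ht _, t, rfl⟩, map_nsmul _ _ _⟩)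
  rw [hset] at h2
  have heq : φ '' (socleAt p k G : Set G) = socleAt p k A := by
    refine Set.eq_of_subset_of_ncard_le ?_ ?_ h1
    · rintro _ ⟨g, ⟨hpg, g', rfl⟩, rfl⟩
      have hpg' : p • p ^ k • g' = 0 := hpg
      exact ⟨show p • φ (p ^ k • g') = 0 by rw [← map_nsmul, hpg', map_zero], φ g',
        (map_nsmul φ _ _).symm⟩
    · rwa [Set.ncard_image_of_injective _ hφ]
  have hz' : z ∈ φ '' (socleAt p k G : Set G) := by rw [heq]; exact hz
  exact hz'

/-- This supplies the height hypothesis of `exists_isCompl_of_heights`. If `p • p • g = 0`, the two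
alternatives of `hA` settle it; in general, subtracting `p ^ (j - 1) • g₁` from `g` lowers the order
of `p • g`. -/
theorem exists_pow_nsmul_eq_of_image (hp : p.Prime) (σ φ : G →+ A) (hσ : Function.Surjective σ)
    (hker : ∀ g, σ g = 0 → ∃ n : ℤ, n ≠ 0 ∧ n • g = 0) (hφ : Function.Injective φ)
    (hA : ∀ k, 1 ≤ k → {x : G | p • x = 0 ∧ ∃ g, p ^ k • g = x}.Finite ∨
      ∀ g : G, p • p • g = 0 → ∃ g', p ^ k • g' = p • g)
    {j : ℕ} (hj : 1 ≤ j) {g : G} (hg : g ∈ primaryPart p G) {u : A}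
    (hu : p ^ j • u = p • φ g) : ∃ g', p ^ j • g' = p • g := by
  have hsoc : ∀ i, 1 ≤ i → ∀ (x : G) (v : A), p • p • x = 0 → p ^ i • v = p • φ x →
      ∃ g', p ^ i • g' = p • x := by
    intro i hi x v hx hv
    rcases hA i hi with hfin | hdiv
    · obtain ⟨y, ⟨-, g', hg'⟩, hy⟩ := exists_socleAt_of_finite hp σ φ hσ hker hφ
        (k := i) (hfin : (socleAt p i G : Set G).Finite) (z := p • φ x)
        ⟨show p • p • φ x = 0 by rw [← map_nsmul, ← map_nsmul, hx, map_zero], v, hv⟩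
      rw [← map_nsmul] at hy
      exact ⟨g', by rw [← hφ hy]; exact hg'⟩
    · exact hdiv x hx
  obtain ⟨e, he⟩ := AddSubgroup.nsmul_mem _ hg p
  induction e generalizing g u with
  | zero => exact ⟨0, by simpa using he.symm⟩
  | succ e ih =>
    obtain ⟨g₁, hg₁⟩ := hsoc (j + e) (by omega) (p ^ e • g) u
      (by rw [← he, pow_succ', mul_smul, smul_comm (p ^ e) p]) (by
        rw [add_comm, pow_add, mul_smul, hu, map_nsmul, smul_comm])
    have e1 : p • p ^ (j - 1) • g₁ = p ^ j • g₁ := by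
      rw [← mul_smul, ← pow_succ', Nat.sub_add_cancel hj]
    have e2 : p ^ e • p • (g - p ^ (j - 1) • g₁) = 0 := by
      have e3 : p ^ e • p ^ j • g₁ = p • p ^ e • g := by rw [← mul_smul, ← pow_add, add_comm, hg₁]
      rw [smul_sub, e1, smul_sub, e3, smul_comm (p ^ e) p, sub_self]
    obtain ⟨g₃, hg₃⟩ := ih (g := g - p ^ (j - 1) • g₁) (u := u - φ g₁)
      (mem_primaryPart_of_pow_nsmul (i := e + 1) ⟨0, by
        rw [pow_zero, one_smul, pow_succ, mul_smul, e2]⟩)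
      (by rw [smul_sub, hu, map_sub, smul_sub, ← map_nsmul φ p (p ^ (j - 1) • g₁), e1, map_nsmul])
      e2
    refine ⟨g₃ + g₁, ?_⟩
    rw [smul_add, hg₃, smul_sub, e1, sub_add_cancel]

theorem exists_primary_decomposition (hp : p.Prime) (σ φ : G →+ A) (hσ : Function.Surjective σ)
    (hker : ∀ g, σ g = 0 → ∃ n : ℤ, n ≠ 0 ∧ n • g = 0) (hφ : Function.Injective φ)
    (hA : ∀ k, 1 ≤ k → {x : G | p • x = 0 ∧ ∃ g, p ^ k • g = x}.Finite ∨
      ∀ g : G, p • p • g = 0 → ∃ g', p ^ k • g' = p • g) :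
    ∃ S C : AddSubgroup A, S ≤ primaryPart p A ∧ C ≤ primaryPart p A ∧ (∀ x ∈ S, x ∈ C → x = 0) ∧
      primaryPart p A ≤ S ⊔ C ∧ (∀ g, φ g ∈ primaryPart p A → φ g ∈ S) ∧
      ∀ u, p • u = 0 → u ∈ φ.range ⊔ C := by
  have hφp : ∀ g, φ g ∈ primaryPart p A → g ∈ primaryPart p G := by
    rintro g ⟨e, he⟩
    exact ⟨e, hφ (by rw [map_nsmul, he, map_zero])⟩
  obtain ⟨N, hN⟩ := exists_divisible_multiple hA
  obtain ⟨S, C, hSC, hS, hC⟩ := exists_isCompl_of_heights (U := primaryPart p A) hp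
    (fun u => u.2.imp fun e he => Subtype.ext he) (N := N)
    (fun u => by
      obtain ⟨t, ht, htu⟩ := exists_mem_primaryPart_of_surjective hp σ hσ hker u.2
      obtain ⟨t', ht'⟩ := hN t ht
      have e : p ^ (N + 1) • σ t' = p ^ N • (u : A) := by rw [← map_nsmul, ht', map_nsmul, htu]
      exact ⟨⟨σ t', mem_primaryPart_of_pow_nsmul (i := N + 1) (by
        rw [e]; exact AddSubgroup.nsmul_mem _ u.2 _)⟩, Subtype.ext e⟩)
    (φ.range.comap (primaryPart p A).subtype)
    (by
      rintro j hj ⟨_, hk⟩ ⟨g, rfl⟩ u hu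
      obtain ⟨g', hg'⟩ := exists_pow_nsmul_eq_of_image hp σ φ hσ hker hφ hA hj (hφp g hk)
        (u := u) (congrArg Subtype.val hu)
      have e : p ^ j • φ g' = p • φ g := by rw [← map_nsmul, hg', map_nsmul]
      exact ⟨⟨φ g', mem_primaryPart_of_pow_nsmul (i := j) (by
        rw [e]; exact AddSubgroup.nsmul_mem _ hk _)⟩, ⟨g', rfl⟩, Subtype.ext e⟩)
  refine ⟨S.map (primaryPart p A).subtype, C.map (primaryPart p A).subtype, ?_, ?_, ?_, ?_, ?_, ?_⟩
  · rintro _ ⟨x, -, rfl⟩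
    exact x.2
  · rintro _ ⟨x, -, rfl⟩
    exact x.2
  · rintro _ ⟨x, hx, rfl⟩ ⟨y, hy, hxy⟩
    obtain rfl : y = x := Subtype.ext hxy
    rw [AddSubgroup.isCompl_mem_eq_zero hSC hx hy, map_zero]
  · intro x hx
    obtain ⟨s, hs, c, hc, h⟩ := AddSubgroup.isCompl_exists_add hSC ⟨x, hx⟩
    exact AddSubgroup.mem_sup.mpr ⟨s, ⟨s, hs, rfl⟩, c, ⟨c, hc, rfl⟩, congrArg Subtype.val h⟩
  · intro g hg
    exact ⟨⟨φ g, hg⟩, hS ⟨g, rfl⟩, rfl⟩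
  · intro u hu
    obtain ⟨k, hk, c, hc, h⟩ := AddSubgroup.mem_sup.mp
      (hC ⟨u, 1, by rw [pow_one, hu]⟩ (Subtype.ext hu))
    exact AddSubgroup.mem_sup.mpr ⟨k, hk, c, ⟨c, hc, rfl⟩, congrArg Subtype.val h⟩

/-- Under `PrimeCondition`, the image of an embedding into a quotient by a torsion subgroup has a
complement as far as the prime `p` is concerned. -/
theorem PrimeCondition.exists_decomposition (hp : p.Prime) (h : PrimeCondition p G) (σ φ : G →+ A)
    (hσ : Function.Surjective σ) (hker : ∀ g, σ g = 0 → ∃ n : ℤ, n ≠ 0 ∧ n • g = 0)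
    (hφ : Function.Injective φ) :
    ∃ (C : AddSubgroup A) (R : AddSubgroup (A ⧸ φ.range)), C ≤ primaryPart p A ∧
      R ≤ primaryPart p _ ∧ (∀ c ∈ C, c ∈ φ.range → c = 0) ∧
      (∀ x ∈ C.map (QuotientAddGroup.mk' φ.range), x ∈ R → x = 0) ∧
      primaryPart p _ ≤ C.map (QuotientAddGroup.mk' φ.range) ⊔ R ∧
      ∀ u, p • u = 0 → u ∈ φ.range ⊔ C := by
  obtain ⟨hA, hB⟩ := h
  have hmk : ∀ a, QuotientAddGroup.mk' φ.range a = 0 ↔ a ∈ φ.range := fun a =>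
    QuotientAddGroup.eq_zero_iff a
  rcases hB with hfin | hB
  · refine ⟨⊥, primaryPart p _, bot_le, le_rfl, fun c hc _ => hc, ?_, le_sup_right, ?_⟩
    · rintro _ ⟨x, hx, rfl⟩ -
      rw [AddSubgroup.mem_bot.mp hx, map_zero]
    · intro u hu
      have hfin0 : (socleAt p 0 G : Set G).Finite := hfin.subset fun x hx => hx.1
      obtain ⟨g, -, rfl⟩ := exists_socleAt_of_finite hp σ φ hσ hker hφ hfin0 (z := u)
        ⟨hu, u, by simp⟩
      exact AddSubgroup.mem_sup_left ⟨g, rfl⟩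
  obtain ⟨S, C, hS, hC, hSC, hsup, hφS, hsoc⟩ :=
    exists_primary_decomposition hp σ φ hσ hker hφ hA
  have hCφ : ∀ c ∈ C, c ∈ φ.range → c = 0 := by
    rintro _ hc ⟨g, rfl⟩
    exact hSC _ (hφS g (hC hc)) hc
  have hCp : C.map (QuotientAddGroup.mk' φ.range) ≤ primaryPart p _ := by
    rintro _ ⟨c, hc, rfl⟩
    exact (hC hc).imp fun e he => by rw [← map_nsmul, he, map_zero]
  rcases hB with hdiv | hdiv
  -- As a summand of an image of the divisible `p`-torsion of `G`, `C` is divisible, so its image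
  -- splits off.
  · have hCdiv : ∀ c ∈ C, ∃ c' ∈ C, p • c' = c := by
      intro c hc
      obtain ⟨t, ht, rfl⟩ := exists_mem_primaryPart_of_surjective hp σ hσ hker (hC hc)
      obtain ⟨g, rfl⟩ := hdiv t ht
      have hg : σ g ∈ primaryPart p A := mem_primaryPart_of_pow_nsmul (i := 1) (by
        rw [pow_one, ← map_nsmul]; exact hC hc)
      obtain ⟨s, hs, c', hc', hsc⟩ := AddSubgroup.mem_sup.mp (hsup hg)
      refine ⟨c', hc', ?_⟩
      have e : p • s = σ (p • g) - p • c' := by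
        rw [map_nsmul, ← hsc, smul_add, add_sub_cancel_right]
      have h0 : p • s = 0 :=
        hSC _ (S.nsmul_mem hs p) (by rw [e]; exact C.sub_mem hc (C.nsmul_mem hc' p))
      rw [h0] at e
      exact (sub_eq_zero.mp e.symm).symm
    obtain ⟨R, hR⟩ := AddSubgroup.exists_isCompl_of_prime_divisible hp
      (C.map (QuotientAddGroup.mk' φ.range)) (fun x hx => hCp hx) (by
        rintro _ ⟨c, hc, rfl⟩
        obtain ⟨c', hc', rfl⟩ := hCdiv c hc
        exact ⟨_, ⟨c', hc', rfl⟩, (map_nsmul _ _ _).symm⟩)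
    refine ⟨C, R ⊓ primaryPart p _, hC, inf_le_right, hCφ, fun x hx hxR =>
      AddSubgroup.isCompl_mem_eq_zero hR hx hxR.1, fun x hx => ?_, hsoc⟩
    obtain ⟨c, hc, r, hr, rfl⟩ := AddSubgroup.isCompl_exists_add hR x
    refine AddSubgroup.add_mem_sup hc ⟨hr, ?_⟩
    have := AddSubgroup.sub_mem _ hx (hCp hc)
    rwa [add_sub_cancel_left] at this
  -- Here `p`-primary elements of `A ⧸ φ.range` lift to `p`-primary ones: if `p ^ e • a = φ g` and
  -- `g = t + p ^ e • g'`, use `a - φ g'`. So the image of `S` serves as `R`.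
  · have hdiv' : ∀ (e : ℕ) (g : G), ∃ t ∈ primaryPart p G, ∃ g', g = t + p ^ e • g' := by
      intro e
      induction e with
      | zero => exact fun g => ⟨0, AddSubgroup.zero_mem _, g, by simp⟩
      | succ e ih =>
        intro g
        obtain ⟨t, ht, g', rfl⟩ := ih g
        obtain ⟨t', g'', ht', rfl⟩ := hdiv g'
        exact ⟨t + p ^ e • t', AddSubgroup.add_mem _ ht (AddSubgroup.nsmul_mem _ ht' _), g'', by
          rw [smul_add, pow_succ, mul_smul, add_assoc]⟩
    refine ⟨C, S.map (QuotientAddGroup.mk' φ.range), hC, ?_, hCφ, ?_, ?_, hsoc⟩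
    · rintro _ ⟨s, hs, rfl⟩
      exact (hS hs).imp fun e he => by rw [← map_nsmul, he, map_zero]
    · rintro _ ⟨c, hc, rfl⟩ ⟨s, hs, hsc⟩
      have h1 : s - c ∈ φ.range := by rw [← hmk, map_sub, hsc, sub_self]
      obtain ⟨g, hg⟩ := h1
      have h2 : s - c ∈ S := by
        rw [← hg]
        exact hφS g (by rw [hg]; exact AddSubgroup.sub_mem _ (hS hs) (hC hc))
      have h3 : c ∈ S := by
        have := S.sub_mem hs h2
        rwa [sub_sub_cancel] at this
      rw [hSC c h3 hc, map_zero]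
    · intro q hq
      obtain ⟨a, rfl⟩ := QuotientAddGroup.mk'_surjective _ q
      obtain ⟨e, he⟩ := hq
      rw [← map_nsmul, hmk] at he
      obtain ⟨g, hg⟩ := he
      obtain ⟨t, ht, g', rfl⟩ := hdiv' e g
      have h1 : a - φ g' ∈ primaryPart p A := by
        refine mem_primaryPart_of_pow_nsmul (i := e) ?_
        rw [smul_sub, ← hg, map_add, map_nsmul, add_sub_cancel_right]
        exact ht.imp fun e he => by rw [← map_nsmul, he, map_zero]
      obtain ⟨s, hs, c, hc, hsc⟩ := AddSubgroup.mem_sup.mp (hsup h1)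
      refine AddSubgroup.mem_sup.mpr ⟨_, ⟨c, hc, rfl⟩, _, ⟨s, hs, rfl⟩, ?_⟩
      have h2 : QuotientAddGroup.mk' φ.range (φ g') = 0 := (hmk _).mpr ⟨g', rfl⟩
      rw [← map_add, add_comm, hsc, map_sub, h2, sub_zero]

end Quotient

/-! ### Sufficiency of the prime condition in finite rank -/

/-- `σ` and `φ` together force equal ranks. A finite rank cancels in rank additivity, so the kernel
of `σ` and the cokernel of `φ` have rank zero. -/
theorem torsion_of_finite_rank.{u} {G A : Type u} [AddCommGroup G] [AddCommGroup A]
    (hG : HasFiniteTorsionFreeRank G) (σ φ : G →+ A) (hσ : Function.Surjective σ)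
    (hφ : Function.Injective φ) :
    (∀ g, σ g = 0 → ∃ n : ℤ, n ≠ 0 ∧ n • g = 0) ∧
      ∀ a : A, ∃ n : ℤ, n ≠ 0 ∧ n • a ∈ φ.range := by
  have hle : Module.rank ℤ G ≤ Module.rank ℤ A :=
    LinearMap.rank_le_of_injective φ.toIntLinearMap hφ
  have hge : Module.rank ℤ A ≤ Module.rank ℤ G :=
    LinearMap.rank_le_of_surjective σ.toIntLinearMap hσ
  have heq := le_antisymm hle hge
  have hfin : Module.rank ℤ G < Cardinal.aleph0 := hG
  constructor
  · have h1 := LinearMap.rank_range_add_rank_ker σ.toIntLinearMap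
    have h2 : LinearMap.range σ.toIntLinearMap = ⊤ := LinearMap.range_eq_top.mpr hσ
    rw [h2, rank_top, ← heq] at h1
    have h3 : Module.rank ℤ (LinearMap.ker σ.toIntLinearMap) = 0 := by
      refine Cardinal.eq_of_add_eq_add_left (h1.trans (add_zero _).symm) hfin
    intro g hg
    obtain ⟨n, hn, h⟩ := rank_eq_zero_iff.mp h3 ⟨g, hg⟩
    exact ⟨n, hn, congrArg Subtype.val h⟩
  · have h1 := Submodule.rank_quotient_add_rank (LinearMap.range φ.toIntLinearMap)
    have h2 : Module.rank ℤ (LinearMap.range φ.toIntLinearMap) = Module.rank ℤ G :=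
      rank_range_of_injective φ.toIntLinearMap hφ
    rw [h2, ← heq, add_comm] at h1
    have h3 := Cardinal.eq_of_add_eq_add_left (h1.trans (add_zero _).symm) hfin
    intro a
    obtain ⟨n, hn, h⟩ := rank_eq_zero_iff.mp h3 (Submodule.Quotient.mk a)
    rw [← Submodule.Quotient.mk_smul, Submodule.Quotient.mk_eq_zero] at h
    exact ⟨n, hn, h⟩

/-- The complement is the sum of the `C p`, and the summand is the preimage of the sum of the `R p`.
Its elements of prime order lie in `φ(G)`, which is essential in it because `(G ⧸ H) ⧸ φ.range` is
torsion. -/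
theorem isSemiGenCoBassian_of_primeCondition {G : Type*} [AddCommGroup G]
    (hG : HasFiniteTorsionFreeRank G) (h : ∀ p : ℕ, p.Prime → PrimeCondition p G) :
    IsSemiGenCoBassian G := by
  intro H φ hφ
  have hσ := QuotientAddGroup.mk'_surjective H
  obtain ⟨hker, htor⟩ := torsion_of_finite_rank hG (QuotientAddGroup.mk' H) φ hσ hφ
  choose C R hC hR hCφ hCR hsup hsoc using fun p : {p : ℕ // p.Prime} =>
    (h p p.2).exists_decomposition p.2 (QuotientAddGroup.mk' H) φ hσ hker hφ
  have hmk : ∀ a, QuotientAddGroup.mk' φ.range a = 0 ↔ a ∈ φ.range := fun a =>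
    QuotientAddGroup.eq_zero_iff a
  have hCp : ∀ p : {p : ℕ // p.Prime},
      (C p).map (QuotientAddGroup.mk' φ.range) ≤ primaryPart p _ := by
    rintro p _ ⟨c, hc, rfl⟩
    exact (hC p hc).imp fun e he => by rw [← map_nsmul, he, map_zero]
  have hcompl := isCompl_iSup_of_primaryPart (Q := (G ⧸ H) ⧸ φ.range)
    (fun q => by
      obtain ⟨a, rfl⟩ := QuotientAddGroup.mk'_surjective _ q
      obtain ⟨n, hn, hna⟩ := htor a
      exact ⟨n, hn, by rw [← map_zsmul, hmk]; exact hna⟩)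
    (fun p => (C p).map (QuotientAddGroup.mk' φ.range)) R hCp hR hCR hsup
  rw [← AddSubgroup.map_iSup] at hcompl
  have hCK : ∀ c ∈ ⨆ p, C p, c ∈ φ.range → c = 0 := by
    intro c hc hcφ
    obtain ⟨n, hn, hnc⟩ := exists_zsmul_eq_zero_of_mem_iSup C hC hc
    refine eq_zero_of_zsmul_eq_zero_of_prime ((⨆ p, C p) ⊓ φ.range) ?_ ⟨hc, hcφ⟩ hn hnc
    rintro p hp y ⟨hyC, hyφ⟩ hy
    exact hCφ ⟨p, hp⟩ y (mem_of_mem_iSup_of_mem_primaryPart C hC ⟨p, hp⟩ hyC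
      (mem_primaryPart_of_nsmul_eq_zero hy)) hyφ
  have hSC := AddSubgroup.isCompl_comap_of_isCompl_map hCK hcompl
  refine ⟨_, ⟨_, hSC⟩, fun k hk => ?_, fun B hB hB0 hinf => hB0 ?_⟩
  · change QuotientAddGroup.mk' φ.range k ∈ ⨆ p, R p
    rw [(hmk k).mpr hk]
    exact AddSubgroup.zero_mem _
  have hB' : ∀ b ∈ B, b ∈ φ.range → b = 0 := fun b hb hbφ => by
    have : b ∈ φ.range ⊓ B := ⟨hbφ, hb⟩
    rwa [hinf] at this
  rw [eq_bot_iff]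
  intro b hb
  obtain ⟨n, hn, hnb⟩ := htor b
  refine eq_zero_of_zsmul_eq_zero_of_prime B ?_ hb hn (hB' _ (B.zsmul_mem hb n) hnb)
  intro p hp u hu hpu
  obtain ⟨k, hk, c, hc, rfl⟩ := AddSubgroup.mem_sup.mp (hsoc ⟨p, hp⟩ u hpu)
  have hcR : QuotientAddGroup.mk' φ.range c ∈ ⨆ p, R p := by
    have h1 : QuotientAddGroup.mk' φ.range (k + c) ∈ ⨆ p, R p := hB hu
    rwa [map_add, (hmk k).mpr hk, zero_add] at h1
  have hc0 := AddSubgroup.isCompl_mem_eq_zero hcompl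
    ⟨c, (le_iSup C ⟨p, hp⟩) hc, rfl⟩ hcR
  exact hB' _ hu (φ.range.add_mem hk ((hmk c).mp hc0))

/-! ### Invariance of the condition under localization -/

/-- A homomorphism that becomes an isomorphism after localization at the prime `p`. -/
structure IsLocallyBijective (p : ℕ) {G M : Type*} [AddCommGroup G] [AddCommGroup M]
    (ι : G →+ M) : Prop where
  exists_smul_eq_zero : ∀ g, ι g = 0 → ∃ s : ℤ, ¬ (p : ℤ) ∣ s ∧ s • g = 0
  exists_eq_smul : ∀ m, ∃ s : ℤ, ¬ (p : ℤ) ∣ s ∧ ∃ g, ι g = s • m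

theorem coe_socleAt_zero (p : ℕ) (A : Type*) [AddCommGroup A] :
    (socleAt p 0 A : Set A) = {x : A | p • x = 0} := by
  ext x
  exact ⟨fun hx => hx.1, fun hx => ⟨hx, x, by simp⟩⟩

namespace IsLocallyBijective

variable {p : ℕ} {G M : Type*} [AddCommGroup G] [AddCommGroup M] {ι : G →+ M}

/-- Integers prime to `p` act invertibly on `p`-primary elements; so, with `exists_primaryPart`, `ι`
is an isomorphism of the `p`-primary parts and preserves heights there. -/
theorem injOn_primaryPart (h : IsLocallyBijective p ι) (hp : p.Prime) {t t' : G}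
    (ht : t ∈ primaryPart p G) (ht' : t' ∈ primaryPart p G) (heq : ι t = ι t') : t = t' := by
  obtain ⟨s, hs, hst⟩ := h.exists_smul_eq_zero (t - t') (by rw [map_sub, heq, sub_self])
  obtain ⟨e, he⟩ := AddSubgroup.sub_mem _ ht ht'
  obtain ⟨k, hk⟩ := exists_zsmul_eq_of_coprime (Int.isCoprime_prime_pow hp hs e) he
  rw [smul_comm, hst, smul_zero] at hk
  exact sub_eq_zero.mp hk.symm

theorem exists_primaryPart (h : IsLocallyBijective p ι) (hp : p.Prime) {m : M}
    (hm : m ∈ primaryPart p M) : ∃ t ∈ primaryPart p G, ι t = m := by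
  obtain ⟨s, hs, g, hg⟩ := h.exists_eq_smul m
  obtain ⟨e, he⟩ := hm
  obtain ⟨s', hs', hg'⟩ := h.exists_smul_eq_zero (p ^ e • g)
    (by rw [map_nsmul, hg, smul_comm, he, smul_zero])
  have hss : ¬ (p : ℤ) ∣ s' * s := fun hd =>
    ((Nat.prime_iff_prime_int.mp hp).dvd_or_dvd hd).elim hs' hs
  obtain ⟨k, hk⟩ := exists_zsmul_eq_of_coprime (Int.isCoprime_prime_pow hp hss e) he
  refine ⟨k • s' • g, ⟨e, ?_⟩, ?_⟩
  · rw [smul_comm, smul_comm (p ^ e) s', hg', smul_zero]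
  · rw [map_zsmul, map_zsmul, hg, ← mul_smul s', smul_comm, hk]

theorem map_mem_primaryPart (ι : G →+ M) {t : G} (ht : t ∈ primaryPart p G) :
    ι t ∈ primaryPart p M :=
  ht.imp fun e he => by rw [← map_nsmul, he, map_zero]

theorem exists_pow_nsmul_eq_iff (h : IsLocallyBijective p ι) (hp : p.Prime) {t : G}
    (ht : t ∈ primaryPart p G) (k : ℕ) : (∃ m, p ^ k • m = ι t) ↔ ∃ g, p ^ k • g = t := by
  constructor
  · rintro ⟨m, hm⟩
    obtain ⟨g, hg, rfl⟩ := h.exists_primaryPart hp (m := m) (mem_primaryPart_of_pow_nsmul (i := k)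
      (by rw [hm]; exact map_mem_primaryPart ι ht))
    exact ⟨g, h.injOn_primaryPart hp (AddSubgroup.nsmul_mem _ hg _) ht (by rw [map_nsmul, hm])⟩
  · rintro ⟨g, rfl⟩
    exact ⟨ι g, (map_nsmul ι _ _).symm⟩

theorem image_socleAt (h : IsLocallyBijective p ι) (hp : p.Prime) (k : ℕ) :
    ι '' (socleAt p k G : Set G) = socleAt p k M := by
  ext m
  constructor
  · rintro ⟨g, ⟨hg, hgk⟩, rfl⟩
    exact ⟨show p • ι g = 0 by rw [← map_nsmul, show p • g = 0 from hg, map_zero],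
      (h.exists_pow_nsmul_eq_iff hp (mem_primaryPart_of_nsmul_eq_zero hg) k).mpr hgk⟩
  · rintro ⟨hm, hmk⟩
    have hm' : p • m = 0 := hm
    obtain ⟨g, hg, rfl⟩ := h.exists_primaryPart hp (mem_primaryPart_of_nsmul_eq_zero hm)
    refine ⟨g, ⟨h.injOn_primaryPart hp (AddSubgroup.nsmul_mem _ hg p) (AddSubgroup.zero_mem _) ?_,
      (h.exists_pow_nsmul_eq_iff hp hg k).mp hmk⟩, rfl⟩
    change ι (p • g) = ι 0
    rw [map_nsmul, hm', map_zero]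

theorem finite_socleAt_iff (h : IsLocallyBijective p ι) (hp : p.Prime) (k : ℕ) :
    (socleAt p k M : Set M).Finite ↔ (socleAt p k G : Set G).Finite := by
  rw [← h.image_socleAt hp k]
  exact Set.finite_image_iff fun x hx y hy hxy => h.injOn_primaryPart hp
    (mem_primaryPart_of_nsmul_eq_zero hx.1) (mem_primaryPart_of_nsmul_eq_zero hy.1) hxy

theorem primary_divisible_iff (h : IsLocallyBijective p ι) (hp : p.Prime) :
    (∀ t ∈ primaryPart p M, ∃ m, p • m = t) ↔ ∀ t ∈ primaryPart p G, ∃ g, p • g = t := by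
  constructor
  · intro H t ht
    have := (h.exists_pow_nsmul_eq_iff hp ht 1).mp
    rw [pow_one] at this
    exact this (H _ (map_mem_primaryPart ι ht))
  · intro H m hm
    obtain ⟨t, ht, rfl⟩ := h.exists_primaryPart hp hm
    obtain ⟨g, rfl⟩ := H t ht
    exact ⟨ι g, (map_nsmul ι _ _).symm⟩

theorem socle_pow_nsmul_iff (h : IsLocallyBijective p ι) (hp : p.Prime) (k : ℕ) :
    (∀ m : M, p • p • m = 0 → ∃ m', p ^ k • m' = p • m) ↔
      ∀ g : G, p • p • g = 0 → ∃ g', p ^ k • g' = p • g := by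
  constructor
  · intro H g hg
    rw [← h.exists_pow_nsmul_eq_iff hp (mem_primaryPart_of_nsmul_eq_zero hg) k, map_nsmul]
    exact H _ (by rw [← map_nsmul, ← map_nsmul, hg, map_zero])
  · intro H m hm
    obtain ⟨g, hg, rfl⟩ := h.exists_primaryPart hp (m := m) ⟨2, by rw [pow_two, mul_smul, hm]⟩
    obtain ⟨g', hg'⟩ := H g (h.injOn_primaryPart hp
      (AddSubgroup.nsmul_mem _ (AddSubgroup.nsmul_mem _ hg p) p) (AddSubgroup.zero_mem _)
      (by rw [map_nsmul, map_nsmul, hm, map_zero]))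
    exact ⟨ι g', by rw [← map_nsmul, hg', map_nsmul]⟩

/-- As `s` is invertible modulo `p`, the denominators from `exists_eq_smul` do not affect membership
in `T + pA`. -/
theorem exists_add_nsmul_of_zsmul {A : Type*} [AddCommGroup A] (hp : p.Prime) {s : ℤ}
    (hs : ¬ (p : ℤ) ∣ s) {a t b : A} (ht : t ∈ primaryPart p A) (hab : s • a = t + p • b) :
    ∃ t a', t ∈ primaryPart p A ∧ a = t + p • a' := by
  obtain ⟨x, y, hxy⟩ := Int.isCoprime_prime_pow hp hs 1
  rw [pow_one] at hxy
  refine ⟨x • t, x • b + y • a, AddSubgroup.zsmul_mem _ ht x, ?_⟩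
  have : a = (x * s + y * p) • a := by rw [hxy, one_smul]
  rw [add_smul, mul_smul, hab, mul_smul, natCast_zsmul] at this
  rw [smul_add, smul_comm p x, smul_comm p y, ← add_assoc, ← smul_add]
  exact this

theorem add_smul_iff (h : IsLocallyBijective p ι) (hp : p.Prime) :
    (∀ m : M, ∃ t m', t ∈ primaryPart p M ∧ m = t + p • m') ↔
      ∀ g : G, ∃ t g', t ∈ primaryPart p G ∧ g = t + p • g' := by
  constructor
  · intro H g
    obtain ⟨_, m, ht', hgm⟩ := H (ι g)
    obtain ⟨t, ht, rfl⟩ := h.exists_primaryPart hp ht'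
    obtain ⟨s, hs, g', hg'⟩ := h.exists_eq_smul m
    obtain ⟨s', hs', hz⟩ := h.exists_smul_eq_zero (s • g - (s • t + p • g')) (by
      rw [map_sub, map_add, map_zsmul, map_zsmul, map_nsmul, hg', hgm, smul_add, smul_comm s p,
        sub_self])
    refine exists_add_nsmul_of_zsmul hp (s := s' * s) (t := s' • s • t) (b := s' • g')
      (fun hd => ((Nat.prime_iff_prime_int.mp hp).dvd_or_dvd hd).elim hs' hs)
      (AddSubgroup.zsmul_mem _ (AddSubgroup.zsmul_mem _ ht s) s') ?_
    rw [smul_sub, sub_eq_zero] at hz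
    rw [mul_smul, hz, smul_add, smul_comm s' p]
  · intro H m
    obtain ⟨s, hs, g, hg⟩ := h.exists_eq_smul m
    obtain ⟨t, g', ht, rfl⟩ := H g
    exact exists_add_nsmul_of_zsmul hp hs (map_mem_primaryPart ι ht) (b := ι g')
      (by rw [← hg, map_add, map_nsmul])

theorem primeCondition_iff (h : IsLocallyBijective p ι) (hp : p.Prime) :
    PrimeCondition p M ↔ PrimeCondition p G := by
  have h0 : ({x : M | p • x = 0}.Finite ↔ {x : G | p • x = 0}.Finite) := by
    have := h.finite_socleAt_iff hp 0
    rwa [coe_socleAt_zero, coe_socleAt_zero] at this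
  exact and_congr
    (forall₂_congr fun k _ => or_congr (h.finite_socleAt_iff hp k) (h.socle_pow_nsmul_iff hp k))
    (or_congr h0 (or_congr (h.primary_divisible_iff hp) (h.add_smul_iff hp)))

end IsLocallyBijective

/-! ### The localization `G_(p)` and the main theorem -/

theorem mem_primeToMonoid {p : ℕ} [Fact p.Prime] {s : ℤ} :
    s ∈ primeToMonoid p ↔ ¬ (p : ℤ) ∣ s := by
  rw [Ideal.mem_primeCompl_iff, Ideal.mem_span_singleton]

/-- The `ℤ`-action on `M` is left arbitrary because the localized module carries its own, which
agrees with the canonical one by uniqueness. -/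
theorem IsLocalizedModule.isLocallyBijective {p : ℕ} [Fact p.Prime] {G M : Type*} [AddCommGroup G]
    [AddCommGroup M] {inst : Module ℤ M} (f : G →ₗ[ℤ] M) [IsLocalizedModule (primeToMonoid p) f] :
    IsLocallyBijective p f.toAddMonoidHom where
  exists_smul_eq_zero g hg := by
    obtain ⟨s, hs⟩ := (IsLocalizedModule.eq_zero_iff (primeToMonoid p) f).mp hg
    exact ⟨s, mem_primeToMonoid.mp s.2, hs⟩
  exists_eq_smul m := by
    obtain ⟨⟨g, s⟩, hgs⟩ := IsLocalizedModule.surj (primeToMonoid p) f m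
    exact ⟨s, mem_primeToMonoid.mp s.2, g, hgs.symm.trans (int_smul_eq_zsmul inst s m)⟩

theorem IsLocalizedModule.eq_zero_of_zsmul_eq_zero {G M : Type*} [AddCommGroup G]
    [AddCommGroup M] {inst : Module ℤ M} {S : Submonoid ℤ} (f : G →ₗ[ℤ] M) [IsLocalizedModule S f]
    {s : ℤ} (hs : s ∈ S) {m : M} (hm : s • m = 0) : m = 0 := by
  obtain rfl : inst = AddCommGroup.toIntModule M := Subsingleton.elim _ _
  exact IsLocalizedModule.smul_injective f ⟨s, hs⟩ (hm.trans (smul_zero s).symm)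

theorem HasFiniteTorsionFreeRank.of_isLocalizedModule.{u} {G M : Type u} [AddCommGroup G]
    [AddCommGroup M] (hG : HasFiniteTorsionFreeRank G) {S : Submonoid ℤ}
    (hS : S ≤ nonZeroDivisors ℤ) {inst : Module ℤ M} (f : G →ₗ[ℤ] M) [IsLocalizedModule S f] :
    HasFiniteTorsionFreeRank M := by
  have h := IsLocalizedModule.rank_eq S hS f
  obtain rfl : inst = AddCommGroup.toIntModule M := Subsingleton.elim _ _
  exact h.trans_lt hG

theorem HasFiniteTorsionFreeRank.localizationAtPrime {G : Type*} [AddCommGroup G]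
    (hG : HasFiniteTorsionFreeRank G) (p : ℕ) [Fact p.Prime] :
    HasFiniteTorsionFreeRank (LocalizationAtPrime p G) :=
  hG.of_isLocalizedModule (S := primeToMonoid p)
    (fun _ hs => mem_nonZeroDivisors_of_ne_zero fun h => mem_primeToMonoid.mp hs (h ▸ dvd_zero _))
    (LocalizedModule.mkLinearMap (primeToMonoid p) G)

theorem LocalizationAtPrime.isLocallyBijective (p : ℕ) [Fact p.Prime] (G : Type*)
    [AddCommGroup G] :
    IsLocallyBijective p (M := LocalizationAtPrime p G)
      (LocalizedModule.mkLinearMap (primeToMonoid p) G).toAddMonoidHom :=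
  IsLocalizedModule.isLocallyBijective _

theorem LocalizationAtPrime.primeCondition_of_ne {p q : ℕ} [hp : Fact p.Prime] (hq : q.Prime)
    (hqp : q ≠ p) (G : Type*) [AddCommGroup G] : PrimeCondition q (LocalizationAtPrime p G) := by
  have hs : (q : ℤ) ∈ primeToMonoid p := mem_primeToMonoid.mpr fun h =>
    hqp ((Nat.prime_dvd_prime_iff_eq hp.out hq).mp (by exact_mod_cast h)).symm
  have h0 : ∀ x : LocalizationAtPrime p G, q • x = 0 → x = 0 := fun x hx =>
    IsLocalizedModule.eq_zero_of_zsmul_eq_zero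
      (LocalizedModule.mkLinearMap (primeToMonoid p) G) hs ((natCast_zsmul x q).trans hx)
  have hfin : {x : LocalizationAtPrime p G | q • x = 0}.Finite :=
    (Set.finite_singleton 0).subset fun x hx => h0 x hx
  exact ⟨fun k _ => Or.inl (hfin.subset fun x hx => hx.1), Or.inl hfin⟩

theorem corollary2 {G : Type*} [AddCommGroup G] (hG : HasFiniteTorsionFreeRank G) :
    IsSemiGenCoBassian G ↔
      ∀ (p : ℕ) [Fact p.Prime], IsSemiGenCoBassian (LocalizationAtPrime p G) := by
  constructor
  · intro h p hp
    refine isSemiGenCoBassian_of_primeCondition (hG.localizationAtPrime p) fun q hq => ?_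
    by_cases hqp : q = p
    · subst hqp
      exact ((LocalizationAtPrime.isLocallyBijective q G).primeCondition_iff hq).mpr
        (h.primeCondition hq)
    · exact LocalizationAtPrime.primeCondition_of_ne hq hqp G
  · intro h
    refine isSemiGenCoBassian_of_primeCondition hG fun p hp => ?_
    have : Fact p.Prime := ⟨hp⟩
    exact ((LocalizationAtPrime.isLocallyBijective p G).primeCondition_iff hp).mp
      ((h p).primeCondition hp)
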